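/- Let $0<\alpha<1$, $T>0$, $M\ge 0$, and let $X$ be a real Banach space with norm $\|\cdot\|$ (for instance $X=L^2(\Omega)$). Let $u:[0,T]\to X$ satisfy $u(0)=0$, $u\in C^2((0,T];X)$ and $\|u^{(m)}(t)\|\le M\,t^{\alpha-m}$ for $m=0,1,2$ and $0<t\le T$. For a step size $h>0$ put $t_n=nh$, and for $1\le p\le 6$ let $$\partial_h^\alpha u(t_n)=\sum_{j=0}^n w_{n-j}\,u(t_j),\qquad \sum_{j=0}^\infty w_j\zeta^j=\Big(\frac{\delta(\zeta)}{h}\Big)^{\alpha},\qquad \delta(\zeta)=\sum_{k=1}^p\frac{(1-\zeta)^k}{k},$$ be the BDF($p$)-based convolution quadrature (CQ) approximation of the Caputo derivative $$\partial_t^\alpha u(t)=\frac1{\Gamma(1-\alpha)}\int_0^t (t-s)^{-\alpha}u'(s)\,ds .$$ Let $\zeta_n(h)=\partial_t^\alpha u(t_n)-\partial_h^\alpha u(t_n)$ be the truncation error. Then the bound $$h^\alpha\sum_{j=0}^{n-1}(n-j)^{\alpha-1}\,\|\zeta_{j+1}(h)\|\le A(h)+B(h)\,t_n^{\alpha-1}\qquad\text{for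 all } n\ge 1 \text{ with } t_n\le T$$ holds with $$A(h)=0,\qquad B(h)=C\begin{cases} h\ln(h^{-1}), & p=1,\\ h, & 2\le p\le 6,\end{cases}$$ for all $h>0$ if $p\ge2$, and for all $0<h\le h_0$ if $p=1$, where $h_0\in(0,1)$ is arbitrary. Here $C>0$ depends only on $\alpha$, $p$, $T$, $M$ and (for $p=1$) $h_0$, and in particular not on $h$, $n$ or $u$. -/

import Mathlib

noncomputable section

/-- The Caputo derivative of order `α ∈ (0,1)` of a vector-valued function,
`(1 / Γ(1-α)) ∫₀ᵗ (t-s)^(-α) u'(s) ds` (Bochner integral). -/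
def caputoDeriv {E : Type*} [NormedAddCommGroup E] [NormedSpace ℝ E]
    (α : ℝ) (u : ℝ → E) (t : ℝ) : E :=
  (Real.Gamma (1 - α))⁻¹ • ∫ s in (0 : ℝ)..t, ((t - s) ^ (-α)) • deriv u s

/-- The symbol `δ(ζ) = ∑_{k=1}^p (1-ζ)^k / k` of the BDF method of order `p`. -/
def bdfSymbol (p : ℕ) (ζ : ℝ) : ℝ :=
  ∑ k ∈ Finset.Icc 1 p, (1 - ζ) ^ k / (k : ℝ)

/-- The convolution quadrature weights `w_j`, given by `∑_j w_j ζ^j = (δ(ζ)/h)^α`, that is, the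
Taylor coefficients at `ζ = 0` of the right-hand side (which is analytic there, as `δ(0) > 0`). -/
def cqWeight (p : ℕ) (α h : ℝ) (j : ℕ) : ℝ :=
  iteratedDeriv j (fun ζ : ℝ => (bdfSymbol p ζ / h) ^ α) 0 / (j.factorial : ℝ)

/-- The convolution quadrature approximation `∑_{j=0}^n w_{n-j} u(t_j)`, with `t_j = j h`, of the
Caputo derivative at `t_n`. -/
def cqDeriv {E : Type*} [NormedAddCommGroup E] [NormedSpace ℝ E]
    (p : ℕ) (α h : ℝ) (u : ℝ → E) (n : ℕ) : E :=
  ∑ j ∈ Finset.range (n + 1), cqWeight p α h (n - j) • u ((j : ℝ) * h)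

/-- The truncation error `ζ_n(h)`: Caputo derivative at `t_n = n h` minus its approximation. -/
def truncationError {E : Type*} [NormedAddCommGroup E] [NormedSpace ℝ E]
    (p : ℕ) (α h : ℝ) (u : ℝ → E) (n : ℕ) : E :=
  caputoDeriv α u ((n : ℝ) * h) - cqDeriv p α h u n

/-- The discrete fractional integral `h^α ∑_{j=0}^{n-1} (n-j)^(α-1) F_{j+1}`. -/
def discreteFracIntegral (α h : ℝ) (F : ℕ → ℝ) (n : ℕ) : ℝ :=
  h ^ α * ∑ j ∈ Finset.range n, ((n : ℝ) - (j : ℝ)) ^ (α - 1) * F (j + 1)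

/-- For the step size `h`, the numbers `A` and `B` bound the discrete fractional integral of the
norm of the truncation error at all mesh points `t_n = n h ∈ (0, T]`:
`h^α ∑_{j=0}^{n-1} (n-j)^(α-1) ‖ζ_{j+1}(h)‖ ≤ A + B t_n^(α-1)`. -/
def TruncationBound {E : Type*} [NormedAddCommGroup E] [NormedSpace ℝ E]
    (p : ℕ) (α T : ℝ) (u : ℝ → E) (h A B : ℝ) : Prop :=
  ∀ n : ℕ, 1 ≤ n → (n : ℝ) * h ≤ T →
    discreteFracIntegral α h (fun k => ‖truncationError p α h u k‖) n
      ≤ A + B * ((n : ℝ) * h) ^ (α - 1)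

/-- The regularity of the solution: `u(0) = 0`, `u` is `C²` on `(0,T]`, and
`‖u^(m)(t)‖ ≤ M t^(α-m)` for `m = 0, 1, 2` and `0 < t ≤ T` (one-sided derivatives at `T`). -/
structure SolutionRegularity {E : Type*} [NormedAddCommGroup E] [NormedSpace ℝ E]
    (α T M : ℝ) (u : ℝ → E) : Prop where
  initial : u 0 = 0
  contDiffOn : ContDiffOn ℝ 2 u (Set.Ioc 0 T)
  bound : ∀ m : ℕ, m ≤ 2 → ∀ t ∈ Set.Ioc 0 T,
    ‖iteratedDerivWithin m u (Set.Ioc 0 T) t‖ ≤ M * t ^ (α - (m : ℝ))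

/-- The rate: `h ln(h⁻¹)` for `p = 1`, and `h` for `p ≥ 2`. -/
def bdfRate (p : ℕ) (h : ℝ) : ℝ :=
  if p = 1 then h * Real.log h⁻¹ else h

end

/-! ### The BDF symbol near the closed unit disc -/

section

open Filter Topology Metric Set

/-! Rescaling `v(s) = u(s h)` reduces everything to step size one: the truncation error is `h^(-α)`
times that of `v`, and `v` obeys the same bounds with `M h^α` in place of `M`. So the powers of `h`
cancel, and it suffices to show that the step-one error at `n` is `O(n^(-σ))`, with `σ = 1` for `p =
1` and some `σ > 1` for `p ≥ 2` (`exists_rescaled_error_bound`).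

Summation by parts writes the step-one error as `∫ k(n - s) v'(s) ds`, where `k` compares `x^(-α) /
Γ(1-α)` with the partial sums of the weights. Its primitive `K` compares `x^(1-α) / Γ(2-α)` with the
linear interpolant of the second sums `V`. Near `s = 0`, where `v''` is not controlled integrably,
the form with `k` and `v'` is used; away from `0` one integrates by parts to reach `K` and `v''`.

The decay of `k` and `K` comes from generating functions (`exists_cq_sums`). With `δ(z) = (1-z)
g(z)`, zero-stability makes `g` zero-free on a disc larger than the unit disc, so `g^α = 1 + c(1-z)
+ (1-z)² Q(z)` with rapidly decaying coefficients of `Q`. Hence `V` consists of coefficients of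
`(1-z)^(α-2)` and `(1-z)^(α-1)` plus an `O(n^(-1-α))` remainder. If `p ≥ 2`, then `g'(1) = -1/2`, so
`c = α/2`; exactly this value cancels the next term of the expansion, and `K = O(x^(-1-α))`. For `p
= 1` only `K = O(x^(-α))` is available.

For `p ≥ 2` the kernel is integrable, and splitting at `s = 1/2` gives `σ = min(1+α, 2-α)`; for `p =
1`, splitting at `n/2` gives `σ = 1`. Finally the discrete fractional integral of `j^(-σ)` is at
most a constant times `n^(α-1) (∑ j^(-σ) + 1/α)`, where the sum is bounded for `σ > 1` and harmonic
for `σ = 1`, hence the logarithm. -/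

/-- The cofactor `δ(z) / (1 - z) = ∑_{k < p} (1 - z)^k / (k + 1)` of the BDF symbol. -/
noncomputable def bdfCofactor {K : Type*} [Field K] (p : ℕ) (z : K) : K :=
  ∑ k ∈ Finset.range p, (1 - z) ^ k / ((k : K) + 1)

theorem bdfSymbol_eq_mul_bdfCofactor (p : ℕ) (x : ℝ) :
    bdfSymbol p x = (1 - x) * bdfCofactor p x := by
  unfold bdfSymbol bdfCofactor
  rw [Finset.mul_sum, ← Finset.Ico_add_one_right_eq_Icc, Finset.sum_Ico_eq_sum_range]
  refine Finset.sum_congr (by simp) fun k _ => ?_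
  push_cast
  rw [pow_add, pow_one, add_comm (1 : ℝ), mul_div_assoc]

theorem bdfCofactor_pos {p : ℕ} (hp : 1 ≤ p) {x : ℝ} (hx : x ≤ 1) : 0 < bdfCofactor p x := by
  unfold bdfCofactor
  obtain ⟨m, rfl⟩ : ∃ m, p = m + 1 := ⟨p - 1, by omega⟩
  rw [Finset.sum_range_succ']
  have : 0 ≤ ∑ k ∈ Finset.range m, (1 - x) ^ (k + 1) / (((k + 1 : ℕ) : ℝ) + 1) :=
    Finset.sum_nonneg fun k _ => div_nonneg (pow_nonneg (by linarith) _) (by positivity)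
  simp only [pow_zero, Nat.cast_zero, zero_add, div_one]
  linarith

theorem bdfCofactor_ofReal (p : ℕ) (x : ℝ) :
    bdfCofactor p (x : ℂ) = ((bdfCofactor p x : ℝ) : ℂ) := by
  simp [bdfCofactor]

theorem bdfCofactor_one {p : ℕ} (hp : 1 ≤ p) : bdfCofactor p (1 : ℂ) = 1 := by
  unfold bdfCofactor
  rw [Finset.sum_eq_single 0] <;> simp +contextual
  omega

theorem differentiable_bdfCofactor (p : ℕ) : Differentiable ℂ (bdfCofactor p : ℂ → ℂ) := by
  unfold bdfCofactor
  fun_prop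

/-- Transfers derivatives between the real and the complex cofactor; needed to compare the
holomorphic logarithm with `Real.log` and to see that the expansion coefficient at `1` is real. -/
theorem hasDerivAt_bdfCofactor_real (p : ℕ) (y : ℝ) :
    HasDerivAt (bdfCofactor p : ℝ → ℝ) (deriv (bdfCofactor p) (y : ℂ)).re y ∧
      (((deriv (bdfCofactor p) (y : ℂ)).re : ℝ) : ℂ) = deriv (bdfCofactor p) (y : ℂ) := by
  have hg := (differentiable_bdfCofactor p y).hasDerivAt
  have h1 : HasDerivAt (fun t : ℝ => ((bdfCofactor p t : ℝ) : ℂ))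
      (deriv (bdfCofactor p) (y : ℂ)) y := by
    simpa only [bdfCofactor_ofReal] using hg.comp_ofReal
  have h2 : HasDerivAt (bdfCofactor p : ℝ → ℝ) (deriv (bdfCofactor p) (y : ℂ)).re y := by
    simpa only [bdfCofactor_ofReal, Complex.ofReal_re] using hg.real_of_complex
  exact ⟨h2, h2.ofReal_comp.unique h1⟩

/-- Second-order consistency of the method: only the term `k = 1` contributes. This is the one place
where `p = 1` behaves differently. -/
theorem hasDerivAt_bdfCofactor_one {p : ℕ} (hp : 2 ≤ p) :
    HasDerivAt (bdfCofactor p : ℂ → ℂ) (-1 / 2) 1 := by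
  have h : HasDerivAt (fun z : ℂ => ∑ k ∈ Finset.range p, (1 - z) ^ k / ((k : ℂ) + 1))
      (∑ k ∈ Finset.range p, ((k : ℂ) * (1 - 1) ^ (k - 1) * (-1)) / ((k : ℂ) + 1)) 1 := by
    refine HasDerivAt.fun_sum fun k _ => ?_
    refine HasDerivAt.div_const ?_ _
    exact ((hasDerivAt_id (1 : ℂ)).const_sub 1).pow k
  convert! h using 1
  rw [Finset.sum_eq_single 1]
  · norm_num
  · intro k _ hk
    rcases Nat.eq_zero_or_pos k with rfl | hk0
    · simp
    · have : k - 1 ≠ 0 := by omega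
      simp [this]
  · intro hk
    simp at hk
    omega

/-- A polynomial of degree at most five whose constant coefficient dominates has no zero in the
closed unit disc. -/
theorem quintic_ne_zero_of_dominant {a₀ a₁ a₂ a₃ a₄ a₅ : ℝ}
    (h : |a₁| + |a₂| + |a₃| + |a₄| + |a₅| < |a₀|) {z : ℂ} (hz : ‖z‖ ≤ 1) :
    (a₀ + a₁ * z + a₂ * z ^ 2 + a₃ * z ^ 3 + a₄ * z ^ 4 + a₅ * z ^ 5 : ℂ) ≠ 0 := by
  intro h0
  have e : (a₀ : ℂ) = -(a₁ * z + a₂ * z ^ 2 + a₃ * z ^ 3 + a₄ * z ^ 4 + a₅ * z ^ 5) := by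
    linear_combination h0
  have key : ∀ (a : ℝ) (k : ℕ), ‖(a : ℂ) * z ^ k‖ ≤ |a| := fun a k => by
    rw [norm_mul, norm_pow, Complex.norm_real, Real.norm_eq_abs]
    exact mul_le_of_le_one_right (abs_nonneg _) (pow_le_one₀ (norm_nonneg _) hz)
  have e' := congrArg norm e
  rw [norm_neg, Complex.norm_real, Real.norm_eq_abs] at e'
  have t1 := norm_add_le (a₁ * z + a₂ * z ^ 2 + a₃ * z ^ 3 + a₄ * z ^ 4 : ℂ) (a₅ * z ^ 5)
  have t2 := norm_add_le (a₁ * z + a₂ * z ^ 2 + a₃ * z ^ 3 : ℂ) (a₄ * z ^ 4)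
  have t3 := norm_add_le (a₁ * z + a₂ * z ^ 2 : ℂ) (a₃ * z ^ 3)
  have t4 := norm_add_le (a₁ * z : ℂ) (a₂ * z ^ 2)
  have k1 := key a₁ 1
  rw [pow_one] at k1
  linarith [key a₂ 2, key a₃ 3, key a₄ 4, key a₅ 5]

/-- Zero-stability of the BDF methods of order at most six. The degrees four to six use Graeffe's
root squaring until the constant coefficient dominates. -/
theorem bdfCofactor_ne_zero {p : ℕ} (hp₁ : 1 ≤ p) (hp₆ : p ≤ 6) {z : ℂ} (hz : ‖z‖ ≤ 1) :
    bdfCofactor p z ≠ 0 := by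
  have hz2 : ‖z ^ 2‖ ≤ 1 := by rw [norm_pow]; exact pow_le_one₀ (norm_nonneg _) hz
  have hz8 : ‖z ^ 8‖ ≤ 1 := by rw [norm_pow]; exact pow_le_one₀ (norm_nonneg _) hz
  intro h
  unfold bdfCofactor at h
  interval_cases p <;> norm_num [Finset.sum_range_succ] at h
  · refine quintic_ne_zero_of_dominant (a₀ := 3) (a₁ := -1) (a₂ := 0) (a₃ := 0) (a₄ := 0)
      (a₅ := 0) (by norm_num [abs_of_pos, abs_of_neg]) hz ?_
    push_cast
    linear_combination 2 * h
  · refine quintic_ne_zero_of_dominant (a₀ := 11) (a₁ := -7) (a₂ := 2) (a₃ := 0) (a₄ := 0)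
      (a₅ := 0) (by norm_num [abs_of_pos, abs_of_neg]) hz ?_
    push_cast
    linear_combination 6 * h
  · refine quintic_ne_zero_of_dominant (a₀ := 625) (a₁ := 121) (a₂ := 31) (a₃ := -9) (a₄ := 0)
      (a₅ := 0) (by norm_num [abs_of_pos, abs_of_neg]) hz2 ?_
    push_cast
    linear_combination 12 * (25 + 23 * z + 13 * z ^ 2 + 3 * z ^ 3) * h
  · refine quintic_ne_zero_of_dominant (a₀ := 18769) (a₁ := 10969) (a₂ := 1519) (a₃ := -681)
      (a₄ := 144) (a₅ := 0) (by norm_num [abs_of_pos, abs_of_neg]) hz2 ?_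
    push_cast
    linear_combination 60 * (137 + 163 * z + 137 * z ^ 2 + 63 * z ^ 3 + 12 * z ^ 4) * h
  -- Each squaring multiplies `P(z)` by `P(-z)`. For `p = 6` the constant coefficient dominates only
  -- after three of them, in the variable `z ^ 8`.
  · have h2 : 21609 + 24309 * z ^ 2 + 4959 * z ^ 4 - 1441 * z ^ 6 + 584 * z ^ 8 - 100 * z ^ 10
        = 0 := by
      linear_combination 60 * (147 + 213 * z + 237 * z ^ 2 + 163 * z ^ 3 + 62 * z ^ 4
        + 10 * z ^ 5) * h
    have h4 : 466948881 - 376609419 * z ^ 4 + 119889531 * z ^ 8 + 8577431 * z ^ 12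
        + 52856 * z ^ 16 - 10000 * z ^ 20 = 0 := by
      linear_combination (21609 - 24309 * z ^ 2 + 4959 * z ^ 4 + 1441 * z ^ 6 + 584 * z ^ 8
        + 100 * z ^ 10) * h2
    refine quintic_ne_zero_of_dominant (a₀ := 218041257467152161) (a₁ := -29870089791387939)
      (a₂ := 20883544354353411) (a₃ := -68430748838689) (a₄ := 174342376736)
      (a₅ := -100000000) (by norm_num [abs_of_pos, abs_of_neg]) hz8 ?_
    push_cast
    linear_combination (466948881 + 376609419 * z ^ 4 + 119889531 * z ^ 8 - 8577431 * z ^ 12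
        + 52856 * z ^ 16 + 10000 * z ^ 20) * h4

/-- A zero-free disc for the cofactor that is larger than the unit disc. -/
theorem exists_ball_bdfCofactor_ne_zero {p : ℕ} (hp₁ : 1 ≤ p) (hp₆ : p ≤ 6) :
    ∃ R : ℝ, 1 < R ∧ ∀ z ∈ ball (0 : ℂ) R, bdfCofactor p z ≠ 0 := by
  have hopen : IsOpen {z : ℂ | bdfCofactor p z ≠ 0} :=
    isOpen_ne_fun (differentiable_bdfCofactor p).continuous continuous_const
  obtain ⟨d, hd, hsub⟩ := (isCompact_closedBall (0 : ℂ) 1).exists_thickening_subset_open hopen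
    fun z hz => bdfCofactor_ne_zero hp₁ hp₆ (by simpa using hz)
  refine ⟨1 + d, by linarith, fun z hz => hsub ?_⟩
  rw [thickening_closedBall hd zero_le_one]
  rwa [add_comm]

/-- A holomorphic logarithm of the cofactor on a disc larger than the unit disc, real on
`(-1, 1]`. -/
theorem exists_log_bdfCofactor {p : ℕ} (hp₁ : 1 ≤ p) (hp₆ : p ≤ 6) :
    ∃ R : ℝ, 1 < R ∧ ∃ f : ℂ → ℂ,
      (∀ z ∈ ball (0 : ℂ) R, HasDerivAt f (deriv (bdfCofactor p) z / bdfCofactor p z) z) ∧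
      f 1 = 0 ∧
      ∀ x : ℝ, -1 < x → x ≤ 1 → f x = (Real.log (bdfCofactor p x) : ℂ) := by
  obtain ⟨R, hR, hne⟩ := exists_ball_bdfCofactor_ne_zero hp₁ hp₆
  have hg := differentiable_bdfCofactor p
  have hd : DifferentiableOn ℂ (fun z => deriv (bdfCofactor p) z / bdfCofactor p z)
      (ball (0 : ℂ) R) :=
    DifferentiableOn.div (hg.differentiableOn.deriv isOpen_ball) hg.differentiableOn hne
  obtain ⟨f, hf1, hf⟩ := hd.isExactOn_ball.with_val_at 1 0
  refine ⟨R, hR, f, hf, hf1, fun x hx hx1 => ?_⟩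
  have hball : ∀ y : ℝ, -1 < y → y ≤ 1 → (y : ℂ) ∈ ball (0 : ℂ) R := fun y h1 h2 => by
    rw [mem_ball_zero_iff, Complex.norm_real, Real.norm_eq_abs]
    exact lt_of_le_of_lt (abs_le.2 ⟨h1.le, h2⟩) hR
  -- On the real segment up to `1`, `f` and the real logarithm have the same derivative, and both
  -- vanish at `1`.
  have hder : ∀ y ∈ Icc x 1, HasDerivAt
      (fun y : ℝ => f y - (Real.log (bdfCofactor p y) : ℂ)) 0 y := by
    intro y hy
    have hb := hball y (lt_of_lt_of_le hx hy.1) hy.2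
    have hpos := bdfCofactor_pos hp₁ hy.2
    have h1 := (hf y hb).comp_ofReal
    obtain ⟨hgr, hre⟩ := hasDerivAt_bdfCofactor_real p y
    have h2 := (hgr.log hpos.ne').ofReal_comp
    have h3 := h1.sub h2
    convert! h3 using 1
    rw [Complex.ofReal_div, hre, bdfCofactor_ofReal, sub_self]
  have hc := constant_of_has_deriv_right_zero
    (fun y hy => (hder y hy).continuousAt.continuousWithinAt)
    (fun y hy => (hder y (Ico_subset_Icc_self hy)).hasDerivWithinAt) 1 ⟨hx1, le_rfl⟩
  have hg1 : bdfCofactor p (1 : ℝ) = 1 := by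
    have := bdfCofactor_one hp₁
    rw [← Complex.ofReal_one, bdfCofactor_ofReal] at this
    exact_mod_cast this
  simp only [Complex.ofReal_one, hf1, hg1, Real.log_one, Complex.ofReal_zero, sub_zero] at hc
  exact sub_eq_zero.1 hc.symm

/-- Coefficients of a function holomorphic on a disc larger than the unit disc. -/
theorem exists_coeff_of_differentiableOn {R : ℝ} (hR : 1 < R) {Q : ℂ → ℂ}
    (hQ : DifferentiableOn ℂ Q (ball 0 R)) :
    ∃ q : ℕ → ℝ, Summable (fun k : ℕ => ((k : ℝ) + 1) ^ 2 * |q k|) ∧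
      ∀ x : ℝ, |x| < 1 → HasSum (fun k => q k * x ^ k) (Q x).re := by
  set r : NNReal := ⟨(1 + R) / 2, by linarith⟩
  have hr : (r : ℝ) = (1 + R) / 2 := rfl
  have hr1 : (1 : ℝ) < r := by rw [hr]; linarith
  have hs := (hQ.mono (closedBall_subset_ball (by rw [hr]; linarith) :
    closedBall (0 : ℂ) r ⊆ ball 0 R)).hasFPowerSeriesOnBall (by
      rw [← NNReal.coe_pos]; linarith)
  set P := cauchyPowerSeries Q 0 r
  set s : NNReal := ⟨(3 + R) / 4, by linarith⟩
  have hsv : (s : ℝ) = (3 + R) / 4 := rfl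
  have hs1 : (1 : ℝ) < s := by rw [hsv]; linarith
  have hsr : s < r := by rw [← NNReal.coe_lt_coe, hr, hsv]; linarith
  obtain ⟨C, hC, hb⟩ := P.norm_mul_pow_le_of_lt_radius (r := s)
    (lt_of_lt_of_le (by exact_mod_cast hsr) hs.r_le)
  have hcoef : ∀ k, ‖P.coeff k‖ ≤ C * ((s : ℝ)⁻¹) ^ k := fun k => by
    have h1 : ‖P.coeff k‖ = ‖P k‖ := by simp
    rw [h1, inv_pow, ← div_eq_mul_inv, le_div_iff₀ (by positivity)]
    exact hb k
  have hinv : ‖(s : ℝ)⁻¹‖ < 1 := by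
    rw [norm_inv, Real.norm_of_nonneg s.coe_nonneg]
    exact inv_lt_one_of_one_lt₀ hs1
  refine ⟨fun k => (P.coeff k).re, ?_, fun x hx => ?_⟩
  · have h2 := summable_pow_mul_geometric_of_norm_lt_one 2 hinv
    have h1 := summable_pow_mul_geometric_of_norm_lt_one 1 hinv
    have h0 := summable_pow_mul_geometric_of_norm_lt_one 0 hinv
    have hsum := ((h2.add (h1.mul_left 2)).add h0).mul_left C
    refine Summable.of_nonneg_of_le (fun k => by positivity) (fun k => ?_) hsum
    calc ((k : ℝ) + 1) ^ 2 * |(P.coeff k).re|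
        ≤ ((k : ℝ) + 1) ^ 2 * (C * ((s : ℝ)⁻¹) ^ k) := by
          gcongr
          exact (Complex.abs_re_le_norm _).trans (hcoef k)
      _ = _ := by ring
  · have hmem : (x : ℂ) ∈ Metric.eball (0 : ℂ) r := by
      rw [Metric.eball_coe, mem_ball_zero_iff, Complex.norm_real, Real.norm_eq_abs]
      linarith
    have h1 := hs.hasSum hmem
    rw [zero_add] at h1
    have h2 := Complex.hasSum_re h1
    convert! h2 using 2 with k
    rw [FormalMultilinearSeries.apply_eq_pow_smul_coeff, smul_eq_mul, ← Complex.ofReal_pow,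
      Complex.re_ofReal_mul, mul_comm]

/-- The second-order expansion at `1` of `(δ(x) / (1 - x)) ^ α`, with remainder coefficients
that decay rapidly. -/
theorem exists_bdfCofactor_rpow_expansion {p : ℕ} (hp₁ : 1 ≤ p) (hp₆ : p ≤ 6) (α : ℝ) :
    ∃ (c : ℝ) (q : ℕ → ℝ), (2 ≤ p → c = α / 2) ∧
      Summable (fun k : ℕ => ((k : ℝ) + 1) ^ 2 * |q k|) ∧
      ∀ x : ℝ, |x| < 1 → HasSum (fun k => q k * x ^ k)
        (((bdfCofactor p x) ^ α - 1 - c * (1 - x)) / (1 - x) ^ 2) := by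
  obtain ⟨R, hR, f, hf, hf1, hfx⟩ := exists_log_bdfCofactor hp₁ hp₆
  set F : ℂ → ℂ := fun z => Complex.exp (α * f z)
  have hFd : ∀ z ∈ ball (0 : ℂ) R, HasDerivAt F
      (F z * (α * (deriv (bdfCofactor p) z / bdfCofactor p z))) z :=
    fun z hz => ((hf z hz).const_mul (α : ℂ)).cexp
  have hF : DifferentiableOn ℂ F (ball 0 R) :=
    fun z hz => (hFd z hz).differentiableAt.differentiableWithinAt
  have h1mem : (1 : ℂ) ∈ ball (0 : ℂ) R := by simpa using hR
  have hnhds : ball (0 : ℂ) R ∈ 𝓝 (1 : ℂ) := isOpen_ball.mem_nhds h1mem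
  have hF1 : F 1 = 1 := by simp [F, hf1]
  -- `F` is the power `g^α`. Dividing out the zero at `1` twice gives `F = 1 + G(1)(z - 1) + (z -
  -- 1)² Q`, with the singularities removed; hence `c = -G(1)`.
  set G := dslope F 1
  set Q := dslope G 1
  have hG : DifferentiableOn ℂ G (ball 0 R) := (Complex.differentiableOn_dslope hnhds).2 hF
  have hQ : DifferentiableOn ℂ Q (ball 0 R) := (Complex.differentiableOn_dslope hnhds).2 hG
  have hG1 : G 1 = α * deriv (bdfCofactor p) 1 := by
    rw [show G 1 = deriv F 1 from dslope_same _ _, (hFd 1 h1mem).deriv, hF1, bdfCofactor_one hp₁]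
    simp
  obtain ⟨q, hq, hsum⟩ := exists_coeff_of_differentiableOn hR hQ
  have hG1re : ((G 1).re : ℂ) = G 1 := by
    have h := (hasDerivAt_bdfCofactor_real p 1).2
    rw [Complex.ofReal_one] at h
    rw [hG1, Complex.re_ofReal_mul, Complex.ofReal_mul, h]
  refine ⟨-(G 1).re, q, fun hp => ?_, hq, fun x hx => ?_⟩
  · rw [hG1, (hasDerivAt_bdfCofactor_one hp).deriv, Complex.re_ofReal_mul]
    norm_num
    ring
  · have hx' := abs_lt.1 hx
    have hpos := bdfCofactor_pos hp₁ hx'.2.le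
    convert hsum x hx using 1
    have hx1 : (1 - x) ≠ 0 := by linarith
    have hFx : F x = ((bdfCofactor p x ^ α : ℝ) : ℂ) := by
      simp only [F]
      rw [hfx x hx'.1 hx'.2.le, Real.rpow_def_of_pos hpos, Complex.ofReal_exp]
      push_cast
      ring_nf
    have e1 := sub_smul_dslope F 1 (x : ℂ)
    have e2 := sub_smul_dslope G 1 (x : ℂ)
    rw [smul_eq_mul, hF1, hFx] at e1
    rw [smul_eq_mul] at e2
    have e3 : ((x - 1 : ℝ) : ℂ) ^ 2 * Q x
        = ((bdfCofactor p x ^ α - 1 - (-(G 1).re) * (1 - x) : ℝ) : ℂ) := by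
      push_cast
      rw [hG1re]
      linear_combination ((x : ℂ) - 1) * e2 + e1
    have e4 := congrArg Complex.re e3
    rw [← Complex.ofReal_pow, Complex.re_ofReal_mul, Complex.ofReal_re] at e4
    rw [← e4]
    field_simp
    ring

end

/-! ### Binomial coefficients and generating functions of the weights -/

section

open Filter Topology

/-- The coefficient of `z ^ n` in `(1 - z) ^ (-β)`. -/
noncomputable def binCoeff (β : ℝ) (n : ℕ) : ℝ :=
  ∏ i ∈ Finset.range n, (β + i) / ((i : ℝ) + 1)

theorem binCoeff_zero (β : ℝ) : binCoeff β 0 = 1 := by simp [binCoeff]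

theorem binCoeff_succ (β : ℝ) (n : ℕ) :
    binCoeff β (n + 1) = binCoeff β n * ((β + n) / ((n : ℝ) + 1)) := by
  rw [binCoeff, Finset.prod_range_succ, binCoeff]

theorem binCoeff_add_one_mul (β : ℝ) (n : ℕ) :
    β * binCoeff (β + 1) n = (β + n) * binCoeff β n := by
  induction n with
  | zero => simp [binCoeff_zero]
  | succ n ih =>
    rw [binCoeff_succ, binCoeff_succ, ← mul_assoc, ih]
    push_cast
    ring

theorem binCoeff_succ_mul (β : ℝ) (n : ℕ) :
    ((n : ℝ) + 1) * binCoeff β (n + 1) = β * binCoeff (β + 1) n := by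
  rw [binCoeff_add_one_mul, binCoeff_succ]
  field_simp

/-- Coefficient form of `(1 - z) (1 - z)^(-(β+1)) = (1 - z)^(-β)`. -/
theorem binCoeff_add_one_sub (β : ℝ) (n : ℕ) :
    binCoeff (β + 1) (n + 1) - binCoeff (β + 1) n = binCoeff β (n + 1) := by
  have h := binCoeff_succ_mul β n
  have hn : (n : ℝ) + 1 ≠ 0 := by positivity
  rw [binCoeff_succ]
  refine mul_left_cancel₀ hn ?_
  rw [h]
  field_simp
  ring

theorem factorial_mul_binCoeff (β : ℝ) (n : ℕ) :
    (n.factorial : ℝ) * binCoeff β n = (ascPochhammer ℝ n).eval β := by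
  induction n with
  | zero => simp [binCoeff_zero]
  | succ n ih =>
    rw [ascPochhammer_succ_eval, ← ih, binCoeff_succ, Nat.factorial_succ]
    push_cast
    field_simp

theorem binCoeff_eq_choose (β : ℝ) (n : ℕ) : binCoeff β n = Ring.choose (β + n - 1) n := by
  rw [← Ring.multichoose_eq]
  have h := Ring.factorial_nsmul_multichoose_eq_ascPochhammer β n
  rw [nsmul_eq_mul, Polynomial.ascPochhammer_smeval_eq_eval, ← factorial_mul_binCoeff] at h
  exact (mul_left_cancel₀ (by positivity) h).symm

theorem hasSum_binCoeff (β : ℝ) {x : ℝ} (hx : |x| < 1) :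
    HasSum (fun n => binCoeff β n * x ^ n) ((1 - x) ^ (-β)) := by
  have h := (Real.one_div_one_sub_rpow_hasFPowerSeriesOnBall_zero β).hasSum (y := x) (by
    simpa [Metric.mem_eball, edist_dist, Real.dist_eq] using hx)
  have hx' := abs_lt.1 hx
  rw [zero_add, one_div, ← Real.rpow_neg (by linarith)] at h
  convert! h using 2 with n
  simp [FormalMultilinearSeries.ofScalars, binCoeff_eq_choose, mul_comm]

/-- Multiplication of a power series by `1 - x` takes backward differences. -/
theorem hasSum_sub_mul_pow {U : ℕ → ℝ} (hU : U 0 = 0) {x s : ℝ}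
    (h : HasSum (fun n => U (n + 1) * x ^ n) s) :
    HasSum (fun n => (U (n + 1) - U n) * x ^ n) ((1 - x) * s) := by
  have h2 : HasSum (fun n => U n * x ^ n) (x * s) := by
    rw [← hasSum_nat_add_iff' 1]
    simp only [Finset.sum_range_one, hU, zero_mul, sub_zero]
    refine (h.mul_left x).congr_fun ?_
    intro n
    ring
  have h3 := h.sub h2
  rw [show (1 - x) * s = s - x * s by ring]
  refine h3.congr_fun ?_
  intro n
  ring

theorem hasSum_mul_antidiagonal {a b : ℕ → ℝ} {x s t : ℝ}
    (ha : HasSum (fun n => a n * x ^ n) s) (hb : HasSum (fun n => b n * x ^ n) t) :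
    HasSum (fun n => (∑ ij ∈ Finset.HasAntidiagonal.antidiagonal n, a ij.1 * b ij.2) * x ^ n) (s * t) := by
  have ha' := ha.summable.norm
  have hb' := hb.summable.norm
  have h1 := (summable_norm_sum_mul_antidiagonal_of_summable_norm ha' hb').of_norm.hasSum
  rw [← tsum_mul_tsum_eq_tsum_sum_antidiagonal_of_summable_norm ha' hb', ha.tsum_eq,
    hb.tsum_eq] at h1
  refine h1.congr_fun ?_
  intro n
  rw [Finset.sum_mul]
  refine Finset.sum_congr rfl fun ij hij => ?_
  rw [← Finset.HasAntidiagonal.mem_antidiagonal.1 hij, pow_add]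
  ring

/-- The sums `∑_{i < n} (n - i) w_i` of the quadrature weights for step size one, from the
expansion `1 + c (1 - z) + (1 - z)^2 ∑ q_k z^k` of `(δ(z) / (1 - z)) ^ α`. -/
noncomputable def cqSecondSum (α c : ℝ) (q : ℕ → ℝ) : ℕ → ℝ
  | 0 => 0
  | n + 1 => binCoeff (2 - α) n + c * binCoeff (1 - α) n
      + ∑ ij ∈ Finset.HasAntidiagonal.antidiagonal n, binCoeff (-α) ij.1 * q ij.2

theorem iteratedDeriv_div_factorial_of_hasSum {f : ℝ → ℝ} {a : ℕ → ℝ}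
    (h : ∀ᶠ x in 𝓝 (0 : ℝ), HasSum (fun n => a n * x ^ n) (f x)) (n : ℕ) :
    iteratedDeriv n f 0 / (n.factorial : ℝ) = a n := by
  have hs : HasFPowerSeriesAt f (FormalMultilinearSeries.ofScalars ℝ a) 0 := by
    rw [hasFPowerSeriesAt_iff]
    filter_upwards [h] with x hx
    rw [zero_add]
    refine hx.congr_fun ?_
    intro k
    simp [FormalMultilinearSeries.coeff_ofScalars, mul_comm]
  obtain ⟨r, hr⟩ := hs
  have h1 := hr.factorial_smul 1 n
  rw [iteratedDeriv_eq_iteratedFDeriv, ← h1]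
  simp [FormalMultilinearSeries.ofScalars]
  field_simp

/-- The shifted second sums have generating function `(1 - x)^(α-2) g(x)^α`; two multiplications by
`1 - x` give `δ(x)^α`, so second differences of the second sums are the weights up to the factor
`h^(-α)`. -/
theorem sum_cqWeight {p : ℕ} (hp : 1 ≤ p) {α c : ℝ} {q : ℕ → ℝ}
    (hq : ∀ x : ℝ, |x| < 1 → HasSum (fun k => q k * x ^ k)
        (((bdfCofactor p x) ^ α - 1 - c * (1 - x)) / (1 - x) ^ 2))
    {h : ℝ} (hh : 0 < h) (n : ℕ) :
    ∑ i ∈ Finset.range (n + 1), cqWeight p α h i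
      = h ^ (-α) * (cqSecondSum α c q (n + 1) - cqSecondSum α c q n) := by
  set V := cqSecondSum α c q
  -- The first differences, shifted by one so that `U 0 = 0`, as the differencing lemma requires.
  set U : ℕ → ℝ := fun n => Nat.casesOn n 0 fun m => V (m + 1) - V m
  have hw : ∀ n, cqWeight p α h n = h ^ (-α) * (U (n + 1) - U n) := by
    intro n
    refine iteratedDeriv_div_factorial_of_hasSum (a := fun n => h ^ (-α) * (U (n + 1) - U n)) ?_ n
    filter_upwards [Metric.ball_mem_nhds (0 : ℝ) one_pos] with x hx
    have hx : |x| < 1 := by simpa using hx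
    have hx1 : 0 < 1 - x := by linarith [(abs_lt.1 hx).2]
    have hg := bdfCofactor_pos hp (by linarith : x ≤ 1)
    have hV : HasSum (fun n => V (n + 1) * x ^ n) ((1 - x) ^ (-(2 - α)) +
        c * (1 - x) ^ (-(1 - α)) + (1 - x) ^ (-(-α)) *
        (((bdfCofactor p x) ^ α - 1 - c * (1 - x)) / (1 - x) ^ 2)) := by
      refine (((hasSum_binCoeff (2 - α) hx).add ((hasSum_binCoeff (1 - α) hx).mul_left c)).add
        (hasSum_mul_antidiagonal (hasSum_binCoeff (-α) hx) (hq x hx))).congr_fun ?_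
      intro n
      simp only [V, cqSecondSum]
      ring
    have hU : HasSum (fun n => U (n + 1) * x ^ n) _ := hasSum_sub_mul_pow rfl hV
    have hw := (hasSum_sub_mul_pow rfl hU).mul_left (h ^ (-α))
    convert! hw using 1
    · ext n
      ring
    · rw [bdfSymbol_eq_mul_bdfCofactor, Real.div_rpow (by positivity) hh.le,
        Real.mul_rpow hx1.le hg.le, Real.rpow_neg hh.le]
      have e1 : (1 - x) ^ (-(2 - α)) = (1 - x) ^ α / (1 - x) ^ 2 := by
        rw [show -(2 - α) = α - (2 : ℕ) by push_cast; ring, Real.rpow_sub_natCast hx1.ne']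
      have e2 : (1 - x) ^ (-(1 - α)) = (1 - x) ^ α / (1 - x) := by
        rw [show -(1 - α) = α - 1 by ring, Real.rpow_sub_one hx1.ne']
      rw [e1, e2, neg_neg]
      field_simp
      ring
  simp only [hw]
  rw [← Finset.mul_sum, Finset.sum_range_sub]
  simp [U]

end

/-! ### Second-order asymptotics of the binomial coefficients -/

section

open Filter Topology

theorem abs_log_one_sub_add_le {y : ℝ} (hy : |y| ≤ 1 / 2) :
    |Real.log (1 - y) + y + y ^ 2 / 2| ≤ 2 * |y| ^ 3 := by
  have h := Real.abs_log_sub_add_sum_range_le (x := y) (by linarith) 2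
  have e : (∑ i ∈ Finset.range 2, y ^ (i + 1) / ((i : ℝ) + 1)) + Real.log (1 - y)
      = Real.log (1 - y) + y + y ^ 2 / 2 := by
    norm_num [Finset.sum_range_succ]
    ring
  rw [e] at h
  refine h.trans ?_
  rw [div_le_iff₀ (by linarith)]
  have : 0 ≤ |y| ^ 3 := by positivity
  norm_num
  nlinarith

theorem factorial_mul_binCoeff_eq_prod (β : ℝ) (n : ℕ) :
    (n.factorial : ℝ) * binCoeff β n = ∏ j ∈ Finset.range n, (β + j) := by
  induction n with
  | zero => simp [binCoeff_zero]
  | succ n ih =>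
    rw [Finset.prod_range_succ, ← ih, binCoeff_succ, Nat.factorial_succ]
    push_cast
    field_simp

theorem binCoeff_pos {β : ℝ} (hβ : 0 < β) (n : ℕ) : 0 < binCoeff β n :=
  Finset.prod_pos fun i _ => by positivity

/-- The logarithm of the ratio of `binCoeff (1 - α) n * (n + 1 - α (1 + α) / 2)` and its
asymptotic value `(n + 1) ^ (1 - α) / Γ(1 - α)`. -/
noncomputable def logRatio (α : ℝ) (n : ℕ) : ℝ :=
  Real.log (binCoeff (1 - α) n) + Real.log ((n : ℝ) + 1 - α * (1 + α) / 2)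
    - (1 - α) * Real.log ((n : ℝ) + 1) + Real.log (Real.Gamma (1 - α))

/-- With `N = n + 1` the increment is a combination of four logarithms `log(1 - a/N)`. Its `1/N`
terms always cancel; its `1/N²` terms cancel exactly because the shift is `α(1+α)/2`. Four cubic
remainders `2/N³` are left. -/
theorem abs_logRatio_succ_sub_le {α : ℝ} (hα₀ : 0 < α) (hα₁ : α < 1) {n : ℕ} (hn : 1 ≤ n) :
    |logRatio α (n + 1) - logRatio α n| ≤ 8 / ((n : ℝ) + 1) ^ 3 := by
  set κ := α * (1 + α) / 2 with hκ
  have hκ0 : 0 < κ := by positivity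
  have hκ1 : κ < 1 := by rw [hκ]; nlinarith
  set N : ℝ := (n : ℝ) + 1 with hN
  have hN2 : 2 ≤ N := by
    have : (1 : ℝ) ≤ n := by exact_mod_cast hn
    linarith
  have hN0 : 0 < N := by linarith
  have key : ∀ a : ℝ, |a| ≤ 1 →
      |Real.log (1 - a / N) + a / N + (a / N) ^ 2 / 2| ≤ 2 / N ^ 3 := by
    intro a ha
    have h1 : |a / N| ≤ 1 / N := by
      rw [abs_div, abs_of_pos hN0]
      gcongr
    have h2 : 1 / N ≤ 1 / 2 := by gcongr
    refine (abs_log_one_sub_add_le (h1.trans h2)).trans ?_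
    calc 2 * |a / N| ^ 3 ≤ 2 * (1 / N) ^ 3 := by gcongr
      _ = 2 / N ^ 3 := by field_simp
  have k1 := key α (by rw [abs_le]; constructor <;> linarith)
  have k2 := key (-(1 - κ)) (by rw [abs_le]; constructor <;> linarith)
  have k3 := key κ (by rw [abs_le]; constructor <;> linarith)
  have k4 := key (-1) (by norm_num)
  have e : logRatio α (n + 1) - logRatio α n = Real.log (1 - α / N)
      + Real.log (1 - (-(1 - κ)) / N) - Real.log (1 - κ / N)
      - (1 - α) * Real.log (1 - (-1) / N) := by
    have f1 : 1 - α / N = (1 - α + n) / N := by rw [hN]; field_simp; ring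
    have f2 : 1 - (-(1 - κ)) / N = (N + 1 - κ) / N := by field_simp; ring
    have f3 : 1 - κ / N = (N - κ) / N := by field_simp
    have f4 : 1 - (-1) / N = (N + 1) / N := by field_simp; ring
    have g1 : 0 < 1 - α + n := by positivity [sub_pos.2 hα₁]
    have g2 : 0 < N - κ := by linarith
    rw [f1, f2, f3, f4, Real.log_div g1.ne' hN0.ne', Real.log_div (by linarith) hN0.ne',
      Real.log_div g2.ne' hN0.ne', Real.log_div (by linarith) hN0.ne']
    simp only [logRatio]
    rw [binCoeff_succ, Real.log_mul (binCoeff_pos (by linarith) n).ne' (by positivity),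
      Real.log_div g1.ne' hN0.ne', ← hκ]
    push_cast
    rw [← hN]
    ring
  rw [e]
  have hα : |1 - α| ≤ 1 := by rw [abs_le]; constructor <;> linarith
  have k4' : |(1 - α) * (Real.log (1 - (-1) / N) + (-1) / N + ((-1) / N) ^ 2 / 2)|
      ≤ 2 / N ^ 3 := by
    rw [abs_mul]
    calc _ ≤ 1 * |Real.log (1 - (-1) / N) + (-1) / N + ((-1) / N) ^ 2 / 2| := by gcongr
      _ ≤ _ := by rw [one_mul]; exact k4
  have e2 : Real.log (1 - α / N) + Real.log (1 - (-(1 - κ)) / N) - Real.log (1 - κ / N)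
      - (1 - α) * Real.log (1 - (-1) / N)
      = (Real.log (1 - α / N) + α / N + (α / N) ^ 2 / 2)
        + (Real.log (1 - (-(1 - κ)) / N) + (-(1 - κ)) / N + ((-(1 - κ)) / N) ^ 2 / 2)
        - (Real.log (1 - κ / N) + κ / N + (κ / N) ^ 2 / 2)
        - (1 - α) * (Real.log (1 - (-1) / N) + (-1) / N + ((-1) / N) ^ 2 / 2) := by
    rw [hκ]
    field_simp
    ring
  rw [e2]
  have e3 : 8 / N ^ 3 = 4 * (2 / N ^ 3) := by ring
  rw [e3]
  rw [abs_le] at k1 k2 k3 k4' ⊢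
  constructor <;> linarith [k1.1, k1.2, k2.1, k2.2, k3.1, k3.2, k4'.1, k4'.2]

/-- This is Gauss's product for `Γ(1 - α)`, up to logarithms of ratios tending to `1`. -/
theorem tendsto_logRatio {α : ℝ} (hα₀ : 0 < α) (hα₁ : α < 1) :
    Tendsto (logRatio α) atTop (𝓝 0) := by
  set κ := α * (1 + α) / 2 with hκ
  have hκ1 : κ < 1 := by rw [hκ]; nlinarith
  have hΓ : 0 < Real.Gamma (1 - α) := Real.Gamma_pos_of_pos (by linarith)
  rw [← tendsto_add_atTop_iff_nat 1]
  have hG := Real.GammaSeq_tendsto_Gamma (1 - α)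
  have hlog := hG.log hΓ.ne'
  have hdiv : ∀ a b : ℝ, Tendsto (fun n : ℕ => Real.log (((n : ℝ) + a) / (n + b))) atTop (𝓝 0) := by
    intro a b
    have h1 : Tendsto (fun n : ℕ => ((n : ℝ) + a) / (n + b)) atTop (𝓝 1) := by
      have hb : Tendsto (fun n : ℕ => (n : ℝ) + b) atTop atTop :=
        tendsto_atTop_add_const_right _ _ tendsto_natCast_atTop_atTop
      have h2 : Tendsto (fun n : ℕ => 1 + (a - b) * ((n : ℝ) + b)⁻¹) atTop (𝓝 (1 + (a - b) * 0)) :=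
        (tendsto_inv_atTop_zero.comp hb).const_mul (a - b) |>.const_add 1
      rw [mul_zero, add_zero] at h2
      refine h2.congr' ?_
      filter_upwards [hb.eventually_gt_atTop 0] with n hn
      field_simp
      ring
    have h3 := h1.log one_ne_zero
    rwa [Real.log_one] at h3
  have hlim : Tendsto (fun n : ℕ => (Real.log (Real.Gamma (1 - α))
      - Real.log (Real.GammaSeq (1 - α) n)) + Real.log (((n : ℝ) + (2 - κ)) / (n + 1))
      + (1 - α) * Real.log (((n : ℝ) + 0) / (n + 2))) atTop (𝓝 0) := by
    have := ((hlog.const_sub (Real.log (Real.Gamma (1 - α)))).add (hdiv (2 - κ) 1)).add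
      ((hdiv 0 2).const_mul (1 - α))
    simpa using this
  refine hlim.congr' ?_
  filter_upwards [eventually_ge_atTop 1] with n hn
  have hn0 : (0 : ℝ) < n := by exact_mod_cast hn
  have hb := binCoeff_pos (by linarith : 0 < 1 - α) (n + 1)
  have hseq : Real.GammaSeq (1 - α) n
      = (n : ℝ) ^ (1 - α) / (binCoeff (1 - α) (n + 1) * ((n : ℝ) + 1)) := by
    have hP : binCoeff (1 - α) (n + 1) * ((n : ℝ) + 1) * (n.factorial : ℝ)
        = ∏ j ∈ Finset.range (n + 1), (1 - α + j) := by
      have h := factorial_mul_binCoeff_eq_prod (1 - α) (n + 1)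
      rw [← h, Nat.factorial_succ]
      push_cast
      ring
    rw [Real.GammaSeq, ← hP]
    have : (n.factorial : ℝ) ≠ 0 := by positivity
    field_simp
  rw [hseq, Real.log_div (by positivity) (by positivity), Real.log_rpow hn0,
    Real.log_mul hb.ne' (by positivity), Real.log_div (by linarith) (by positivity),
    Real.log_div (by linarith) (by positivity)]
  simp only [logRatio]
  push_cast
  rw [← hκ, show (n : ℝ) + 1 + 1 - κ = n + (2 - κ) by ring,
    show (n : ℝ) + 1 + 1 = n + 2 by ring, add_zero]
  ring

/-- The increments `8/N³` are dominated by the differences of `16/N²`, so adding or subtracting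
`16/N²` makes the sequence monotone with limit `0`. -/
theorem abs_logRatio_le {α : ℝ} (hα₀ : 0 < α) (hα₁ : α < 1) {n : ℕ} (hn : 1 ≤ n) :
    |logRatio α n| ≤ 16 / ((n : ℝ) + 1) ^ 2 := by
  have hstep : ∀ m : ℕ, 8 / (((m + 1 : ℕ) : ℝ) + 1) ^ 3
      ≤ 16 / (((m + 1 : ℕ) : ℝ) + 1) ^ 2 - 16 / (((m + 1 + 1 : ℕ) : ℝ) + 1) ^ 2 := by
    intro m
    push_cast
    set x : ℝ := (m : ℝ)
    have hx : 0 ≤ x := Nat.cast_nonneg m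
    rw [div_sub_div _ _ (by positivity) (by positivity), div_le_div_iff₀ (by positivity)
      (by positivity), ← sub_nonneg]
    have : (16 * (x + 1 + 1 + 1) ^ 2 - (x + 1 + 1) ^ 2 * 16) * (x + 1 + 1) ^ 3
        - 8 * ((x + 1 + 1) ^ 2 * (x + 1 + 1 + 1) ^ 2)
        = 8 * (x + 2) ^ 2 * (3 * x ^ 2 + 12 * x + 11) := by ring
    rw [this]
    positivity
  have hlim : Tendsto (fun m : ℕ => 16 / (((m + 1 : ℕ) : ℝ) + 1) ^ 2) atTop (𝓝 0) := by
    have h1 : Tendsto (fun m : ℕ => ((m + 1 : ℕ) : ℝ) + 1) atTop atTop :=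
      tendsto_atTop_add_const_right _ _
        (tendsto_natCast_atTop_atTop.comp (tendsto_add_atTop_nat 1))
    exact ((tendsto_pow_atTop (two_ne_zero)).comp h1).const_div_atTop 16
  have hd : Tendsto (fun m : ℕ => logRatio α (m + 1)) atTop (𝓝 0) :=
    (tendsto_add_atTop_iff_nat 1).2 (tendsto_logRatio hα₀ hα₁)
  obtain ⟨m, rfl⟩ : ∃ m, n = m + 1 := ⟨n - 1, by omega⟩
  have h1 : Antitone fun m : ℕ => logRatio α (m + 1) + 16 / (((m + 1 : ℕ) : ℝ) + 1) ^ 2 :=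
    antitone_nat_of_succ_le fun k => by
      have := (abs_le.1 (abs_logRatio_succ_sub_le hα₀ hα₁ (n := k + 1) (by omega))).2
      linarith [hstep k]
  have h2 : Monotone fun m : ℕ => logRatio α (m + 1) - 16 / (((m + 1 : ℕ) : ℝ) + 1) ^ 2 :=
    monotone_nat_of_le_succ fun k => by
      have := (abs_le.1 (abs_logRatio_succ_sub_le hα₀ hα₁ (n := k + 1) (by omega))).1
      linarith [hstep k]
  have l1 := h1.le_of_tendsto (by simpa using hd.add hlim) m
  have l2 := h2.ge_of_tendsto (by simpa using hd.sub hlim) m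
  rw [abs_le]
  constructor <;> linarith

theorem abs_exp_sub_one_le_mul_exp (d : ℝ) : |Real.exp d - 1| ≤ |d| * Real.exp |d| := by
  have h1 := Real.add_one_le_exp (-d)
  have h2 := Real.add_one_le_exp d
  have h3 : Real.exp d * Real.exp (-d) = 1 := by rw [← Real.exp_add]; simp
  have h4 : Real.exp d ≤ Real.exp |d| := Real.exp_le_exp.2 (le_abs_self d)
  have h5 : 1 ≤ Real.exp |d| := Real.one_le_exp (abs_nonneg d)
  have h6 := Real.exp_pos d
  rw [abs_le]
  constructor
  · nlinarith [neg_abs_le d, le_abs_self d, abs_nonneg d]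
  · have : Real.exp d - 1 ≤ d * Real.exp d := by nlinarith
    refine this.trans ?_
    calc d * Real.exp d ≤ |d| * Real.exp d := by gcongr; exact le_abs_self d
      _ ≤ _ := by gcongr

/-- Second-order asymptotics of the coefficients of `(1 - z) ^ (α - 1)`. -/
theorem exists_abs_binCoeff_sub_le {α : ℝ} (hα₀ : 0 < α) (hα₁ : α < 1) :
    ∃ C : ℝ, 0 < C ∧ ∀ n : ℕ,
      |binCoeff (1 - α) n * ((n : ℝ) + 1 - α * (1 + α) / 2)
        - ((n : ℝ) + 1) ^ (1 - α) / Real.Gamma (1 - α)| ≤ C * ((n : ℝ) + 1) ^ (-1 - α) := by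
  set κ := α * (1 + α) / 2 with hκ
  have hκ1 : κ < 1 := by rw [hκ]; nlinarith
  have hΓ : 0 < Real.Gamma (1 - α) := Real.Gamma_pos_of_pos (by linarith)
  set D := 16 * Real.exp 16 / Real.Gamma (1 - α)
  -- `D₀` covers `n = 0`, where the bound on `logRatio` is not available.
  set D₀ := |binCoeff (1 - α) 0 * (((0 : ℕ) : ℝ) + 1 - κ)
        - (((0 : ℕ) : ℝ) + 1) ^ (1 - α) / Real.Gamma (1 - α)|
  have hD : 0 < D := by positivity
  have hD₀ : 0 ≤ D₀ := abs_nonneg _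
  refine ⟨D + D₀, by linarith, fun n => ?_⟩
  rcases Nat.eq_zero_or_pos n with rfl | hn
  · simp only [D₀, Nat.cast_zero, zero_add, Real.one_rpow, mul_one] at hD ⊢
    linarith
  have hN : (0 : ℝ) < (n : ℝ) + 1 := by positivity
  have hNκ : 0 < (n : ℝ) + 1 - κ := by
    have : (0 : ℝ) ≤ n := Nat.cast_nonneg n
    linarith
  have hb := binCoeff_pos (by linarith : 0 < 1 - α) n
  have hexp : Real.exp (logRatio α n) = binCoeff (1 - α) n * ((n : ℝ) + 1 - κ)
      / ((n : ℝ) + 1) ^ (1 - α) * Real.Gamma (1 - α) := by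
    simp only [logRatio]
    rw [← hκ, Real.exp_add, Real.exp_sub, Real.exp_add, Real.exp_log hb, Real.exp_log hNκ,
      Real.exp_log hΓ, Real.rpow_def_of_pos hN, mul_comm (1 - α) (Real.log _)]
  have hl := abs_logRatio_le hα₀ hα₁ hn
  have hl2 : |logRatio α n| ≤ 16 := by
    refine hl.trans (div_le_self (by norm_num) ?_)
    have : (0 : ℝ) ≤ n := Nat.cast_nonneg n
    nlinarith
  have e : binCoeff (1 - α) n * ((n : ℝ) + 1 - κ)
        - ((n : ℝ) + 1) ^ (1 - α) / Real.Gamma (1 - α)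
      = ((n : ℝ) + 1) ^ (1 - α) / Real.Gamma (1 - α) * (Real.exp (logRatio α n) - 1) := by
    rw [hexp]
    have : ((n : ℝ) + 1) ^ (1 - α) ≠ 0 := by positivity
    field_simp
  rw [e, abs_mul, abs_of_pos (by positivity)]
  calc ((n : ℝ) + 1) ^ (1 - α) / Real.Gamma (1 - α) * |Real.exp (logRatio α n) - 1|
      ≤ ((n : ℝ) + 1) ^ (1 - α) / Real.Gamma (1 - α)
          * (16 / ((n : ℝ) + 1) ^ 2 * Real.exp 16) := by
        gcongr
        refine (abs_exp_sub_one_le_mul_exp _).trans ?_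
        gcongr
    _ = D * ((n : ℝ) + 1) ^ (-1 - α) := by
        rw [show -1 - α = (1 - α) - (2 : ℕ) by push_cast; ring, Real.rpow_sub_natCast hN.ne']
        simp only [D]
        field_simp
    _ ≤ _ := by
        gcongr
        linarith

end

/-! ### Asymptotics of the first and second sums of the weights -/

section

open Filter Topology

/-- Bernoulli's inequality `(1 + y)^α ≤ 1 + α y` with `b = a(1 + y)`, in place of the mean value
theorem. -/
theorem rpow_neg_sub_rpow_neg_le {α a b : ℝ} (hα₀ : 0 < α) (hα₁ : α < 1) (ha : 0 < a)
    (hab : a ≤ b) : a ^ (-α) - b ^ (-α) ≤ α * a ^ (-1 - α) * (b - a) := by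
  set y := (b - a) / a with hy
  have hy0 : 0 ≤ y := div_nonneg (by linarith) ha.le
  have hb : b = a * (1 + y) := by rw [hy]; field_simp; ring
  have h1 : (1 + y) ^ α ≤ 1 + α * y :=
    rpow_one_add_le_one_add_mul_self (by linarith) hα₀.le hα₁.le
  have h2 : 1 - α * y ≤ (1 + y) ^ (-α) := by
    rw [Real.rpow_neg (by linarith), ← one_div, le_div_iff₀ (by positivity)]
    by_cases hn : 0 ≤ 1 - α * y
    · nlinarith [mul_nonneg hα₀.le hy0]
    · have : 0 < (1 + y) ^ α := by positivity
      nlinarith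
  have e : α * a ^ (-1 - α) * (b - a) = a ^ (-α) * (α * y) := by
    rw [show -1 - α = -α - 1 by ring, Real.rpow_sub_one ha.ne', hb]
    field_simp
    ring
  rw [e, hb, Real.mul_rpow ha.le (by linarith)]
  have : 0 < a ^ (-α) := by positivity
  nlinarith

/-- Convolution with a rapidly decaying sequence preserves polynomial decay. -/
theorem abs_sum_antidiagonal_le {α B : ℝ} (hα₀ : 0 < α) (hα₁ : α < 1) {b q : ℕ → ℝ} (hB : 0 ≤ B)
    (hb : ∀ n : ℕ, |b n| ≤ B * ((n : ℝ) + 1) ^ (-1 - α))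
    (hq : Summable fun k : ℕ => ((k : ℝ) + 1) ^ 2 * |q k|) (n : ℕ) :
    |∑ ij ∈ Finset.HasAntidiagonal.antidiagonal n, b ij.1 * q ij.2|
      ≤ B * (∑' k : ℕ, ((k : ℝ) + 1) ^ 2 * |q k|) * ((n : ℝ) + 1) ^ (-1 - α) := by
  have hterm : ∀ ij ∈ Finset.HasAntidiagonal.antidiagonal n, |b ij.1 * q ij.2|
      ≤ B * ((n : ℝ) + 1) ^ (-1 - α) * (((ij.2 : ℝ) + 1) ^ 2 * |q ij.2|) := by
    intro ij hij
    have hn := Finset.HasAntidiagonal.mem_antidiagonal.1 hij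
    set i : ℝ := (ij.1 : ℝ)
    set k : ℝ := (ij.2 : ℝ)
    have hi : 0 ≤ i := Nat.cast_nonneg _
    have hk : 0 ≤ k := Nat.cast_nonneg _
    have hnr : (n : ℝ) = i + k := by rw [← hn]; push_cast; rfl
    -- Since `n + 1 ≤ (i + 1)(k + 1)`, replacing `i` by `n` costs `(k + 1)^(1+α)`, which the
    -- quadratic weight on `q` pays for.
    have h1 : (i + 1) ^ (-1 - α) ≤ ((n : ℝ) + 1) ^ (-1 - α) * (k + 1) ^ 2 := by
      have h2 : ((i + 1) * (k + 1)) ^ (-1 - α) ≤ ((n : ℝ) + 1) ^ (-1 - α) :=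
        Real.rpow_le_rpow_of_nonpos (by positivity) (by rw [hnr]; nlinarith) (by linarith)
      rw [Real.mul_rpow (by positivity) (by positivity)] at h2
      have h3 : 1 ≤ (k + 1) ^ (-1 - α) * (k + 1) ^ 2 := by
        rw [← Real.rpow_natCast, ← Real.rpow_add (by positivity)]
        exact Real.one_le_rpow (by linarith) (by push_cast; linarith)
      calc (i + 1) ^ (-1 - α) ≤ (i + 1) ^ (-1 - α) * ((k + 1) ^ (-1 - α) * (k + 1) ^ 2) :=
            le_mul_of_one_le_right (by positivity) h3
        _ = (i + 1) ^ (-1 - α) * (k + 1) ^ (-1 - α) * (k + 1) ^ 2 := by ring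
        _ ≤ _ := by gcongr
    rw [abs_mul]
    calc |b ij.1| * |q ij.2| ≤ B * (((n : ℝ) + 1) ^ (-1 - α) * (k + 1) ^ 2) * |q ij.2| := by
          gcongr
          exact (hb ij.1).trans (by gcongr)
      _ = _ := by ring
  calc |∑ ij ∈ Finset.HasAntidiagonal.antidiagonal n, b ij.1 * q ij.2|
      ≤ ∑ ij ∈ Finset.HasAntidiagonal.antidiagonal n, |b ij.1 * q ij.2| :=
        Finset.abs_sum_le_sum_abs _ _
    _ ≤ ∑ ij ∈ Finset.HasAntidiagonal.antidiagonal n,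
          B * ((n : ℝ) + 1) ^ (-1 - α) * (((ij.2 : ℝ) + 1) ^ 2 * |q ij.2|) :=
        Finset.sum_le_sum hterm
    _ = B * ((n : ℝ) + 1) ^ (-1 - α) * ∑ k ∈ Finset.range (n + 1),
          (((k : ℝ) + 1) ^ 2 * |q k|) := by
        rw [← Finset.mul_sum, Finset.Nat.sum_antidiagonal_eq_sum_range_succ
          (fun _ k => ((k : ℝ) + 1) ^ 2 * |q k|), ← Finset.sum_range_reflect]
        congr 1
        refine Finset.sum_congr rfl fun j hj => ?_
        have := Finset.mem_range.1 hj
        rw [show n - (n + 1 - 1 - j) = j by omega]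
    _ ≤ B * ((n : ℝ) + 1) ^ (-1 - α) * ∑' k : ℕ, ((k : ℝ) + 1) ^ 2 * |q k| := by
        gcongr
        exact hq.sum_le_tsum _ fun k _ => by positivity
    _ = _ := by ring

/-- First-order bounds for the coefficients of `(1 - z) ^ (α - 1)` and `(1 - z) ^ α`. -/
theorem exists_binCoeff_bounds {α : ℝ} (hα₀ : 0 < α) (hα₁ : α < 1) :
    ∃ C : ℝ, 0 < C ∧ ∀ n : ℕ, binCoeff (1 - α) n ≤ C * ((n : ℝ) + 1) ^ (-α) ∧
      |binCoeff (1 - α) n - ((n : ℝ) + 1) ^ (-α) / Real.Gamma (1 - α)|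
        ≤ C * ((n : ℝ) + 1) ^ (-1 - α) ∧
      |binCoeff (-α) n| ≤ C * ((n : ℝ) + 1) ^ (-1 - α) := by
  obtain ⟨C₀, hC₀, h₀⟩ := exists_abs_binCoeff_sub_le hα₀ hα₁
  set κ := α * (1 + α) / 2 with hκ
  have hκ0 : 0 < κ := by positivity
  have hκ1 : κ < 1 := by rw [hκ]; nlinarith
  have hΓ : 0 < Real.Gamma (1 - α) := Real.Gamma_pos_of_pos (by linarith)
  set A := (1 / Real.Gamma (1 - α) + C₀) / (1 - κ)
  have hA : 0 < A := div_pos (by positivity) (by linarith)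
  have hpow : ∀ n : ℕ, ((n : ℝ) + 1) ^ (-α) = ((n : ℝ) + 1) * ((n : ℝ) + 1) ^ (-1 - α) ∧
      ((n : ℝ) + 1) ^ (1 - α) = ((n : ℝ) + 1) ^ 2 * ((n : ℝ) + 1) ^ (-1 - α) := by
    intro n
    have hy : (0 : ℝ) < (n : ℝ) + 1 := by positivity
    constructor
    · rw [show -1 - α = -α - 1 by ring, Real.rpow_sub_one hy.ne']
      field_simp
    · rw [show -1 - α = 1 - α - (2 : ℕ) by push_cast; ring, Real.rpow_sub_natCast hy.ne']
      field_simp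
  have h1 : ∀ n : ℕ, binCoeff (1 - α) n ≤ A * ((n : ℝ) + 1) ^ (-α) := by
    intro n
    have hb := binCoeff_pos (by linarith : 0 < 1 - α) n
    have h := (abs_le.1 (h₀ n)).2
    have hy : (1 : ℝ) ≤ (n : ℝ) + 1 := by linarith [(Nat.cast_nonneg n : (0 : ℝ) ≤ n)]
    rw [(hpow n).1]
    rw [(hpow n).2] at h
    set y : ℝ := (n : ℝ) + 1
    set X := y ^ (-1 - α)
    have hX : 0 < X := by positivity
    have h2 : binCoeff (1 - α) n * ((1 - κ) * y) ≤ (1 / Real.Gamma (1 - α) + C₀) * (y ^ 2 * X) := by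
      calc binCoeff (1 - α) n * ((1 - κ) * y) ≤ binCoeff (1 - α) n * (y - κ) := by
            gcongr
            nlinarith
        _ ≤ y ^ 2 * X / Real.Gamma (1 - α) + C₀ * X := by linarith
        _ ≤ y ^ 2 * X / Real.Gamma (1 - α) + C₀ * (y ^ 2 * X) := by
            gcongr
            exact le_mul_of_one_le_left hX.le (one_le_pow₀ hy)
        _ = _ := by ring
    have h3 : binCoeff (1 - α) n * (1 - κ) ≤ (1 / Real.Gamma (1 - α) + C₀) * (y * X) := by
      refine le_of_mul_le_mul_right ?_ (by linarith : 0 < y)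
      calc _ = binCoeff (1 - α) n * ((1 - κ) * y) := by ring
        _ ≤ _ := h2
        _ = _ := by ring
    calc binCoeff (1 - α) n ≤ (1 / Real.Gamma (1 - α) + C₀) * (y * X) / (1 - κ) := by
          rwa [le_div_iff₀ (by linarith)]
      _ = A * (y * X) := by simp only [A]; ring
  refine ⟨C₀ + 4 * A + 1, by positivity, fun n => ⟨?_, ?_, ?_⟩⟩
  · refine (h1 n).trans ?_
    gcongr
    linarith
  · have hb := binCoeff_pos (by linarith : 0 < 1 - α) n
    have h := h₀ n
    have h2 := h1 n
    have hy : (1 : ℝ) ≤ (n : ℝ) + 1 := by linarith [(Nat.cast_nonneg n : (0 : ℝ) ≤ n)]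
    rw [(hpow n).1] at h2 ⊢
    rw [(hpow n).2] at h
    set y : ℝ := (n : ℝ) + 1
    set X := y ^ (-1 - α)
    have hX : 0 < X := by positivity
    refine le_of_mul_le_mul_right ?_ (by linarith : 0 < y)
    have e : |binCoeff (1 - α) n - y * X / Real.Gamma (1 - α)| * y
        = |binCoeff (1 - α) n * (y - κ) - y ^ 2 * X / Real.Gamma (1 - α)
          + κ * binCoeff (1 - α) n| := by
      rw [← abs_of_pos (by linarith : 0 < y), ← abs_mul, abs_of_pos (by linarith : 0 < y)]
      congr 1
      ring
    rw [e]
    calc _ ≤ |binCoeff (1 - α) n * (y - κ) - y ^ 2 * X / Real.Gamma (1 - α)|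
          + |κ * binCoeff (1 - α) n| := abs_add_le _ _
      _ ≤ C₀ * X + 1 * (A * (y * X)) := by
          rw [abs_of_pos (mul_pos hκ0 hb)]
          gcongr
      _ ≤ C₀ * X * y + 4 * A * X * y + 1 * X * y := by
          have t1 : C₀ * X ≤ C₀ * X * y := le_mul_of_one_le_right (by positivity) hy
          have t2 : 0 ≤ A * X * y := by positivity
          have t3 : 0 ≤ X * y := by positivity
          linarith
      _ = _ := by ring
  · rcases n with _ | n
    · rw [binCoeff_zero]
      simp
      linarith
    · have h2 := h1 n
      have hb := binCoeff_pos (by linarith : 0 < 1 - α) n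
      rw [(hpow n).1] at h2
      -- The coefficients of `(1 - z)^α` are `-α/(n + 1)` times those of `(1 - z)^(α-1)`, which
      -- gains one power of decay.
      have e := binCoeff_succ_mul (-α) n
      rw [show -α + 1 = 1 - α by ring] at e
      have hy : (1 : ℝ) ≤ (n : ℝ) + 1 := by linarith [(Nat.cast_nonneg n : (0 : ℝ) ≤ n)]
      push_cast
      have h4 : ((n : ℝ) + 1) ^ (-1 - α) ≤ 4 * ((n : ℝ) + 1 + 1) ^ (-1 - α) := by
        have hle : (2 * ((n : ℝ) + 1)) ^ (-1 - α) ≤ ((n : ℝ) + 1 + 1) ^ (-1 - α) :=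
          Real.rpow_le_rpow_of_nonpos (by positivity) (by linarith) (by linarith)
        rw [Real.mul_rpow (by norm_num) (by positivity)] at hle
        have h2p : 1 ≤ 4 * (2 : ℝ) ^ (-1 - α) := by
          have : (4 : ℝ) = 2 ^ (2 : ℝ) := by norm_num
          rw [this, ← Real.rpow_add (by norm_num)]
          exact Real.one_le_rpow (by norm_num) (by linarith)
        calc ((n : ℝ) + 1) ^ (-1 - α) ≤ 4 * (2 : ℝ) ^ (-1 - α) * ((n : ℝ) + 1) ^ (-1 - α) :=
              le_mul_of_one_le_left (by positivity) h2p
          _ = 4 * ((2 : ℝ) ^ (-1 - α) * ((n : ℝ) + 1) ^ (-1 - α)) := by ring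
          _ ≤ _ := by gcongr
      set y : ℝ := (n : ℝ) + 1
      set X := y ^ (-1 - α)
      set Y := (y + 1) ^ (-1 - α)
      have hY : 0 < Y := by positivity
      have h5 : |binCoeff (-α) (n + 1)| ≤ A * X := by
        refine le_of_mul_le_mul_left ?_ (by linarith : 0 < y)
        rw [← abs_of_pos (by linarith : 0 < y), ← abs_mul, abs_of_pos (by linarith : 0 < y), e,
          abs_mul, abs_neg, abs_of_pos hα₀, abs_of_pos hb]
        calc α * binCoeff (1 - α) n ≤ 1 * (A * (y * X)) := by gcongr
          _ = _ := by ring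
      calc |binCoeff (-α) (n + 1)| ≤ A * (4 * Y) := h5.trans (by gcongr)
        _ ≤ (C₀ + 4 * A + 1) * Y := by nlinarith

/-- Asymptotics of the first and second sums of the quadrature weights. -/
theorem exists_cq_sums {p : ℕ} (hp₁ : 1 ≤ p) (hp₆ : p ≤ 6) {α : ℝ} (hα₀ : 0 < α) (hα₁ : α < 1) :
    ∃ (V : ℕ → ℝ) (C : ℝ), 0 < C ∧ V 0 = 0 ∧
      (∀ h : ℝ, 0 < h → ∀ n : ℕ, ∑ i ∈ Finset.range (n + 1), cqWeight p α h i
        = h ^ (-α) * (V (n + 1) - V n)) ∧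
      (∀ n : ℕ, |V (n + 2) - V (n + 1) - ((n : ℝ) + 1) ^ (-α) / Real.Gamma (1 - α)|
        ≤ C * ((n : ℝ) + 1) ^ (-1 - α)) ∧
      (∀ n : ℕ, |V (n + 1) - ((n : ℝ) + 1) ^ (1 - α) / Real.Gamma (2 - α)|
        ≤ C * ((n : ℝ) + 1) ^ (-α)) ∧
      (2 ≤ p → ∀ n : ℕ, |V (n + 1) - ((n : ℝ) + 1) ^ (1 - α) / Real.Gamma (2 - α)|
        ≤ C * ((n : ℝ) + 1) ^ (-1 - α)) := by
  obtain ⟨c, q, hc, hqs, hq⟩ := exists_bdfCofactor_rpow_expansion hp₁ hp₆ α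
  obtain ⟨C₀, hC₀, h₀⟩ := exists_abs_binCoeff_sub_le hα₀ hα₁
  obtain ⟨C₁, hC₁, h₁⟩ := exists_binCoeff_bounds hα₀ hα₁
  have hr := abs_sum_antidiagonal_le hα₀ hα₁ hC₁.le (fun n => (h₁ n).2.2) hqs
  set D := C₁ * ∑' k : ℕ, ((k : ℝ) + 1) ^ 2 * |q k|
  have hD : 0 ≤ D := mul_nonneg hC₁.le (tsum_nonneg fun k => by positivity)
  have hΓ : 0 < Real.Gamma (1 - α) := Real.Gamma_pos_of_pos (by linarith)
  have hΓ2 : Real.Gamma (2 - α) = (1 - α) * Real.Gamma (1 - α) := by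
    rw [← Real.Gamma_add_one (by linarith)]
    congr 1
    ring
  have h1α : 0 < 1 - α := by linarith
  set V := cqSecondSum α c q
  set r : ℕ → ℝ := fun n => ∑ ij ∈ Finset.HasAntidiagonal.antidiagonal n, binCoeff (-α) ij.1 * q ij.2
  have hVs : ∀ n, V (n + 1) = binCoeff (2 - α) n + c * binCoeff (1 - α) n + r n := fun n => rfl
  -- The value `α/2` of `c` turns the factor `n + 1 - α` of the leading term into `n + 1 -
  -- α(1+α)/2`, for which the sharp asymptotics hold. The surplus `c - α/2` is of order `n^(-α)` and
  -- vanishes for `p ≥ 2`.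
  have hbase : ∀ n : ℕ, |V (n + 1) - ((n : ℝ) + 1) ^ (1 - α) / Real.Gamma (2 - α)
      - (c - α / 2) * binCoeff (1 - α) n| ≤ (C₀ / (1 - α) + D) * ((n : ℝ) + 1) ^ (-1 - α) := by
    intro n
    have e1 := binCoeff_add_one_mul (1 - α) n
    rw [show 1 - α + 1 = 2 - α by ring] at e1
    have e2 : V (n + 1) - ((n : ℝ) + 1) ^ (1 - α) / Real.Gamma (2 - α)
        - (c - α / 2) * binCoeff (1 - α) n
        = (binCoeff (1 - α) n * ((n : ℝ) + 1 - α * (1 + α) / 2)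
          - ((n : ℝ) + 1) ^ (1 - α) / Real.Gamma (1 - α)) / (1 - α) + r n := by
      have e3 : binCoeff (2 - α) n = (1 - α + n) * binCoeff (1 - α) n / (1 - α) := by
        rw [← e1]
        field_simp
      rw [hVs, e3, hΓ2]
      field_simp
      ring
    rw [e2]
    calc _ ≤ |(binCoeff (1 - α) n * ((n : ℝ) + 1 - α * (1 + α) / 2)
          - ((n : ℝ) + 1) ^ (1 - α) / Real.Gamma (1 - α)) / (1 - α)| + |r n| := abs_add_le _ _
      _ ≤ C₀ * ((n : ℝ) + 1) ^ (-1 - α) / (1 - α) + D * ((n : ℝ) + 1) ^ (-1 - α) := by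
          rw [abs_div, abs_of_pos h1α]
          gcongr
          · exact h₀ n
          · exact hr n
      _ = _ := by ring
  have hpowle : ∀ n : ℕ, ((n : ℝ) + 1) ^ (-1 - α) ≤ ((n : ℝ) + 1) ^ (-α) := fun n =>
    Real.rpow_le_rpow_of_exponent_le (by linarith [(Nat.cast_nonneg n : (0 : ℝ) ≤ n)])
      (by linarith)
  set K₁ := C₀ / (1 - α) + D
  set K₂ := K₁ + |c - α / 2| * C₁
  set K₃ := C₁ + |1 + c| * C₁ + 2 * D
  have hK₁ : 0 < K₁ := by positivity
  refine ⟨V, K₂ + K₃, by positivity, rfl, fun h hh n => sum_cqWeight hp₁ hq hh n, fun n => ?_,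
    fun n => ?_, fun hp n => ?_⟩
  · have d1 := binCoeff_add_one_sub (1 - α) n
    have d2 := binCoeff_add_one_sub (-α) n
    rw [show 1 - α + 1 = 2 - α by ring] at d1
    rw [show -α + 1 = 1 - α by ring] at d2
    -- The `1` in `1 + c` comes from lowering the index of the leading coefficient from `n + 1` to
    -- `n`.
    have e : V (n + 2) - V (n + 1) - ((n : ℝ) + 1) ^ (-α) / Real.Gamma (1 - α)
        = (binCoeff (1 - α) n - ((n : ℝ) + 1) ^ (-α) / Real.Gamma (1 - α))
          + (1 + c) * binCoeff (-α) (n + 1) + r (n + 1) + -r n := by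
      rw [hVs (n + 1), hVs n]
      linear_combination d1 + (1 + c) * d2
    have hmono : (((n + 1 : ℕ) : ℝ) + 1) ^ (-1 - α) ≤ ((n : ℝ) + 1) ^ (-1 - α) :=
      Real.rpow_le_rpow_of_nonpos (by positivity) (by push_cast; linarith) (by linarith)
    have b1 := (h₁ n).2.1
    have b2 : |(1 + c) * binCoeff (-α) (n + 1)| ≤ |1 + c| * (C₁ * ((n : ℝ) + 1) ^ (-1 - α)) := by
      rw [abs_mul]
      gcongr
      exact (h₁ (n + 1)).2.2.trans (by gcongr)
    have b3 : |r (n + 1)| ≤ D * ((n : ℝ) + 1) ^ (-1 - α) := (hr (n + 1)).trans (by gcongr)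
    have b4 : |-r n| ≤ D * ((n : ℝ) + 1) ^ (-1 - α) := by rw [abs_neg]; exact hr n
    rw [e]
    refine (abs_add_le _ _).trans ?_
    refine (add_le_add_left ((abs_add_le _ _).trans
      (add_le_add_left (abs_add_le _ _) _)) _).trans ?_
    calc _ ≤ K₃ * ((n : ℝ) + 1) ^ (-1 - α) := by
          simp only [K₃]
          linarith
      _ ≤ _ := by
          gcongr
          have : 0 ≤ K₂ := by positivity
          linarith
  · have hb := binCoeff_pos h1α n
    have b1 := hbase n
    have b2 : |(c - α / 2) * binCoeff (1 - α) n|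
        ≤ |c - α / 2| * (C₁ * ((n : ℝ) + 1) ^ (-α)) := by
      rw [abs_mul, abs_of_pos hb]
      gcongr
      exact (h₁ n).1
    have b3 := abs_add_le (V (n + 1) - ((n : ℝ) + 1) ^ (1 - α) / Real.Gamma (2 - α)
      - (c - α / 2) * binCoeff (1 - α) n) ((c - α / 2) * binCoeff (1 - α) n)
    rw [sub_add_cancel] at b3
    calc _ ≤ K₁ * ((n : ℝ) + 1) ^ (-α) + |c - α / 2| * (C₁ * ((n : ℝ) + 1) ^ (-α)) := by
          have := mul_le_mul_of_nonneg_left (hpowle n) hK₁.le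
          linarith
      _ = K₂ * ((n : ℝ) + 1) ^ (-α) := by simp only [K₂]; ring
      _ ≤ _ := by
          gcongr
          have : 0 ≤ K₃ := by positivity
          linarith
  · have b1 := hbase n
    rw [hc hp, sub_self, zero_mul, sub_zero] at b1
    refine b1.trans ?_
    gcongr
    have h1 : K₁ ≤ K₂ := le_add_of_nonneg_right (by positivity)
    have h2 : 0 ≤ K₃ := by positivity
    linarith

end

/-! ### The error kernels and their decay -/

section

open Filter Topology

/-- The kernel of the truncation error for step size one with respect to the first derivative. -/
noncomputable def stepKernel (α : ℝ) (V : ℕ → ℝ) (x : ℝ) : ℝ :=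
  x ^ (-α) / Real.Gamma (1 - α) - (V (⌊x⌋₊ + 1) - V ⌊x⌋₊)

/-- The piecewise linear interpolant of a sequence. -/
noncomputable def linearInterp (V : ℕ → ℝ) (x : ℝ) : ℝ :=
  V ⌊x⌋₊ + (x - ⌊x⌋₊) * (V (⌊x⌋₊ + 1) - V ⌊x⌋₊)

/-- The kernel of the truncation error for step size one with respect to the second derivative. -/
noncomputable def linearKernel (α : ℝ) (V : ℕ → ℝ) (x : ℝ) : ℝ :=
  x ^ (1 - α) / Real.Gamma (2 - α) - linearInterp V x

theorem linearInterp_of_mem {V : ℕ → ℝ} {m : ℕ} {x : ℝ} (h₁ : (m : ℝ) ≤ x) (h₂ : x ≤ m + 1) :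
    linearInterp V x = V m + (x - m) * (V (m + 1) - V m) := by
  rcases h₂.lt_or_eq with h | h
  · have : ⌊x⌋₊ = m := (Nat.floor_eq_iff ((Nat.cast_nonneg m).trans h₁)).2 ⟨h₁, h⟩
    rw [linearInterp, this]
  · have : ⌊x⌋₊ = m + 1 := by
      rw [h]
      exact_mod_cast Nat.floor_natCast (m + 1)
    rw [linearInterp, this, h]
    push_cast
    ring

/-- Sums of truncated ramps are visibly continuous; this yields continuity of the interpolant across
the integers. -/
theorem linearInterp_min (V : ℕ → ℝ) {x : ℝ} (hx : 0 ≤ x) (N : ℕ) :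
    linearInterp V (min x N)
      = V 0 + ∑ i ∈ Finset.range N, (V (i + 1) - V i) * max 0 (min (x - i) 1) := by
  induction N with
  | zero => simp [linearInterp, hx]
  | succ N ih =>
    rw [Finset.sum_range_succ, ← add_assoc, ← ih]
    push_cast
    have hNN : linearInterp V (N : ℝ) = V N := by simp [linearInterp]
    rcases le_total x N with h | h
    · rw [min_eq_left h, min_eq_left (by linarith), min_eq_left (by linarith),
        max_eq_left (by linarith)]
      ring
    · rcases le_total x (N + 1) with h' | h'
      · rw [min_eq_right h, min_eq_left h', min_eq_left (by linarith), max_eq_right (by linarith),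
          hNN, linearInterp_of_mem h h']
        ring
      · rw [min_eq_right h, min_eq_right h', min_eq_right (by linarith), max_eq_right (by norm_num),
          hNN, linearInterp_of_mem (m := N) (by linarith) le_rfl]
        ring

theorem continuousOn_linearInterp (V : ℕ → ℝ) (N : ℕ) :
    ContinuousOn (linearInterp V) (Set.Icc 0 N) := by
  have h : Continuous fun x : ℝ =>
      V 0 + ∑ i ∈ Finset.range N, (V (i + 1) - V i) * max 0 (min (x - i) 1) := by
    fun_prop
  refine h.continuousOn.congr fun x hx => ?_
  simp only
  rw [← linearInterp_min V hx.1 N, min_eq_left hx.2]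

theorem hasDerivAt_linearInterp (V : ℕ → ℝ) {x : ℝ} (hx : 0 < x) (hx' : (⌊x⌋₊ : ℝ) ≠ x) :
    HasDerivAt (linearInterp V) (V (⌊x⌋₊ + 1) - V ⌊x⌋₊) x := by
  set m := ⌊x⌋₊
  have h1 : (m : ℝ) < x := lt_of_le_of_ne (Nat.floor_le hx.le) hx'
  have h2 : x < m + 1 := Nat.lt_floor_add_one x
  have h : HasDerivAt (fun y : ℝ => V m + (y - m) * (V (m + 1) - V m)) (V (m + 1) - V m) x := by
    have := (((hasDerivAt_id x).sub_const (m : ℝ)).mul_const (V (m + 1) - V m)).const_add (V m)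
    simpa using this
  refine h.congr_of_eventuallyEq ?_
  filter_upwards [Ioo_mem_nhds h1 h2] with y hy
  exact linearInterp_of_mem hy.1.le hy.2.le

theorem continuousOn_linearKernel {α : ℝ} (hα₁ : α < 1) (V : ℕ → ℝ) (N : ℕ) :
    ContinuousOn (linearKernel α V) (Set.Icc 0 N) := by
  have h : Continuous fun x : ℝ => x ^ (1 - α) / Real.Gamma (2 - α) :=
    (Real.continuous_rpow_const (by linarith)).div_const _
  exact h.continuousOn.sub (continuousOn_linearInterp V N)

theorem hasDerivAt_linearKernel {α : ℝ} (hα₁ : α < 1) (V : ℕ → ℝ) {x : ℝ} (hx : 0 < x)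
    (hx' : (⌊x⌋₊ : ℝ) ≠ x) : HasDerivAt (linearKernel α V) (stepKernel α V x) x := by
  have h := (Real.hasDerivAt_rpow_const (x := x) (p := 1 - α) (Or.inl hx.ne')).div_const
    (Real.Gamma (2 - α))
  have h2 := h.sub (hasDerivAt_linearInterp V hx hx')
  convert! h2 using 1
  have hΓ : 0 < Real.Gamma (1 - α) := Real.Gamma_pos_of_pos (by linarith)
  have hΓ2 : Real.Gamma (2 - α) = (1 - α) * Real.Gamma (1 - α) := by
    rw [← Real.Gamma_add_one (by linarith)]
    congr 1
    ring
  have : 1 - α ≠ 0 := by linarith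
  rw [stepKernel, hΓ2, show 1 - α - 1 = -α by ring]
  field_simp

theorem linearKernel_zero {α : ℝ} (hα₁ : α < 1) {V : ℕ → ℝ} (hV : V 0 = 0) :
    linearKernel α V 0 = 0 := by
  simp [linearKernel, linearInterp, hV, Real.zero_rpow (by linarith : 1 - α ≠ 0)]

theorem measurable_stepKernel (α : ℝ) (V : ℕ → ℝ) : Measurable (stepKernel α V) := by
  unfold stepKernel
  refine ((measurable_id.pow_const _).div_const _).sub (Measurable.sub ?_ ?_)
  · exact (measurable_from_nat (f := fun n => V (n + 1))).comp Nat.measurable_floor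
  · exact (measurable_from_nat (f := V)).comp Nat.measurable_floor

/-- Changes of base in decay estimates; `γ ≤ 2` lets the constant `c ^ γ` be replaced by `c ^ 2`. -/
theorem rpow_neg_le_of_le_mul {x y c γ : ℝ} (hx : 0 < x) (hy : 0 < y) (hc : 1 ≤ c) (hγ₀ : 0 ≤ γ)
    (hγ₂ : γ ≤ 2) (h : y ≤ c * x) : x ^ (-γ) ≤ c ^ 2 * y ^ (-γ) := by
  have hc0 : 0 < c := by linarith
  have h1 : (c * x) ^ (-γ) ≤ y ^ (-γ) := Real.rpow_le_rpow_of_nonpos hy h (by linarith)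
  rw [Real.mul_rpow hc0.le hx.le] at h1
  have h2 : 1 ≤ c ^ 2 * c ^ (-γ) := by
    rw [← Real.rpow_natCast, ← Real.rpow_add hc0]
    exact Real.one_le_rpow hc (by push_cast; linarith)
  calc x ^ (-γ) ≤ c ^ 2 * c ^ (-γ) * x ^ (-γ) := le_mul_of_one_le_left (by positivity) h2
    _ = c ^ 2 * (c ^ (-γ) * x ^ (-γ)) := by ring
    _ ≤ _ := by gcongr

/-- The exponent `-1 - α` is for decay, the exponent `-α` for integrability at `0`. Below `1` the
kernel is `x^(-α)/Γ(1-α)` minus a constant; above `1` the asymptotics at the integer part apply.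
Each regime proves its sharper bound, which implies the other one there. -/
theorem exists_abs_stepKernel_le {α C : ℝ} (hα₀ : 0 < α) (hα₁ : α < 1) (hC : 0 < C) {V : ℕ → ℝ}
    (hV : V 0 = 0)
    (hW : ∀ n : ℕ, |V (n + 2) - V (n + 1) - ((n : ℝ) + 1) ^ (-α) / Real.Gamma (1 - α)|
        ≤ C * ((n : ℝ) + 1) ^ (-1 - α)) :
    ∃ D : ℝ, 0 < D ∧ ∀ x : ℝ, 0 < x → |stepKernel α V x| ≤ D * x ^ (-1 - α) ∧
      (|stepKernel α V x| ≤ D * x ^ (-α)) := by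
  have hΓ : 0 < Real.Gamma (1 - α) := Real.Gamma_pos_of_pos (by linarith)
  set D := 4 * (C + 1 / Real.Gamma (1 - α)) + |V 1|
  have hD : 0 < D := by positivity
  refine ⟨D, hD, fun x hx => ?_⟩
  rcases lt_or_ge x 1 with h1 | h1
  · have hf : ⌊x⌋₊ = 0 := Nat.floor_eq_zero.2 h1
    have hle : x ^ (-α) ≤ x ^ (-1 - α) :=
      Real.rpow_le_rpow_of_exponent_ge hx h1.le (by linarith)
    have hone : 1 ≤ x ^ (-α) := Real.one_le_rpow_of_pos_of_le_one_of_nonpos hx h1.le (by linarith)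
    have hb : |stepKernel α V x| ≤ D * x ^ (-α) := by
      rw [stepKernel, hf, hV, sub_zero, zero_add]
      calc |x ^ (-α) / Real.Gamma (1 - α) - V 1|
          ≤ |x ^ (-α) / Real.Gamma (1 - α)| + |V 1| := abs_sub _ _
        _ ≤ 1 / Real.Gamma (1 - α) * x ^ (-α) + |V 1| * x ^ (-α) := by
            rw [abs_of_pos (by positivity)]
            have := le_mul_of_one_le_right (abs_nonneg (V 1)) hone
            have e : x ^ (-α) / Real.Gamma (1 - α) = 1 / Real.Gamma (1 - α) * x ^ (-α) := by ring
            linarith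
        _ = (1 / Real.Gamma (1 - α) + |V 1|) * x ^ (-α) := by ring
        _ ≤ _ := by
            gcongr
            have : 0 < 1 / Real.Gamma (1 - α) := by positivity
            simp only [D]
            linarith
    exact ⟨hb.trans (by gcongr), hb⟩
  · obtain ⟨k, hk⟩ : ∃ k, ⌊x⌋₊ = k + 1 :=
      ⟨⌊x⌋₊ - 1, by have := (Nat.one_le_floor_iff x).2 h1; omega⟩
    have hm1 : ((k : ℝ) + 1) ≤ x := by
      have := Nat.floor_le hx.le
      rw [hk] at this
      exact_mod_cast this
    have hm2 : x < (k : ℝ) + 1 + 1 := by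
      have := Nat.lt_floor_add_one x
      rw [hk] at this
      exact_mod_cast this
    have hk0 : (0 : ℝ) ≤ k := Nat.cast_nonneg k
    have hb : |stepKernel α V x| ≤ D * x ^ (-1 - α) := by
      have b1 := hW k
      have b2 := rpow_neg_sub_rpow_neg_le hα₀ hα₁ (by positivity : 0 < (k : ℝ) + 1) hm1
      have b3 : x ^ (-α) ≤ ((k : ℝ) + 1) ^ (-α) :=
        Real.rpow_le_rpow_of_nonpos (by positivity) hm1 (by linarith)
      have b4 : ((k : ℝ) + 1) ^ (-1 - α) ≤ 2 ^ 2 * x ^ (-1 - α) := by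
        rw [show -1 - α = -(1 + α) by ring]
        exact rpow_neg_le_of_le_mul (by positivity) hx (by norm_num) (by linarith) (by linarith)
          (by linarith)
      rw [stepKernel, hk]
      set m : ℝ := (k : ℝ) + 1
      have hX : 0 < m ^ (-1 - α) := by positivity
      have b5 : α * m ^ (-1 - α) * (x - m) ≤ m ^ (-1 - α) := by
        have : α * (x - m) ≤ 1 := by nlinarith
        nlinarith
      have e : x ^ (-α) / Real.Gamma (1 - α) - (V (k + 1 + 1) - V (k + 1))
          = -(V (k + 2) - V (k + 1) - m ^ (-α) / Real.Gamma (1 - α))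
            - (m ^ (-α) - x ^ (-α)) / Real.Gamma (1 - α) := by ring
      rw [e]
      calc _ ≤ |-(V (k + 2) - V (k + 1) - m ^ (-α) / Real.Gamma (1 - α))|
            + |(m ^ (-α) - x ^ (-α)) / Real.Gamma (1 - α)| := abs_sub _ _
        _ ≤ C * m ^ (-1 - α) + m ^ (-1 - α) / Real.Gamma (1 - α) := by
            rw [abs_neg, abs_of_nonneg (div_nonneg (by linarith) hΓ.le)]
            gcongr
            linarith
        _ = (C + 1 / Real.Gamma (1 - α)) * m ^ (-1 - α) := by ring
        _ ≤ (C + 1 / Real.Gamma (1 - α)) * (2 ^ 2 * x ^ (-1 - α)) := by gcongr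
        _ = 4 * (C + 1 / Real.Gamma (1 - α)) * x ^ (-1 - α) := by ring
        _ ≤ _ := by
            gcongr
            exact le_add_of_nonneg_right (abs_nonneg _)
    exact ⟨hb, hb.trans (by
      gcongr
      linarith)⟩

/-- First-order Taylor expansion at `m`. Bernoulli bounds the power from above; the lower bound
follows from Bernoulli for the exponent `α`, as the two powers multiply to `1 + y`. -/
theorem abs_rpow_one_sub_sub_le {α m x : ℝ} (hα₀ : 0 < α) (hα₁ : α < 1) (hm : 0 < m)
    (hmx : m ≤ x) (hx : x ≤ m + 1) :
    |x ^ (1 - α) - m ^ (1 - α) - (1 - α) * (x - m) * m ^ (-α)| ≤ m ^ (-1 - α) := by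
  set y := (x - m) / m with hy
  have hy0 : 0 ≤ y := div_nonneg (by linarith) hm.le
  have hxy : x = m * (1 + y) := by rw [hy]; field_simp; ring
  have h1 : (1 + y) ^ (1 - α) ≤ 1 + (1 - α) * y :=
    rpow_one_add_le_one_add_mul_self (by linarith) (by linarith) (by linarith)
  have h2 : (1 + y) ^ α ≤ 1 + α * y :=
    rpow_one_add_le_one_add_mul_self (by linarith) hα₀.le hα₁.le
  have h3 : 1 + (1 - α) * y - y ^ 2 ≤ (1 + y) ^ (1 - α) := by
    have hpos : 0 < (1 + y) ^ (1 - α) := by positivity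
    have hmul : (1 + y) ^ (1 - α) * (1 + y) ^ α = 1 + y := by
      rw [← Real.rpow_add (by linarith)]
      simp
    have h4 : 1 + y ≤ (1 + y) ^ (1 - α) * (1 + α * y) := by
      calc 1 + y = (1 + y) ^ (1 - α) * (1 + y) ^ α := hmul.symm
        _ ≤ _ := by gcongr
    have h5 : 0 < 1 + α * y := by positivity
    refine le_of_mul_le_mul_right (h4.trans' ?_) h5
    have : 0 ≤ α * y ^ 3 := by positivity
    nlinarith [mul_nonneg (sub_nonneg.2 hα₁.le) hα₀.le, sq_nonneg y, sq_nonneg (α * y)]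
  have e : x ^ (1 - α) - m ^ (1 - α) - (1 - α) * (x - m) * m ^ (-α)
      = m ^ (1 - α) * ((1 + y) ^ (1 - α) - 1 - (1 - α) * y) := by
    rw [hxy, Real.mul_rpow hm.le (by linarith), show -α = 1 - α - 1 by ring,
      Real.rpow_sub_one hm.ne']
    field_simp
    ring
  have e2 : m ^ (-1 - α) = m ^ (1 - α) * (1 / m) ^ 2 := by
    rw [show -1 - α = 1 - α - (2 : ℕ) by push_cast; ring, Real.rpow_sub_natCast hm.ne']
    field_simp
  have hy1 : y ≤ 1 / m := by
    rw [hy]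
    gcongr
    linarith
  rw [e, e2, abs_mul, abs_of_pos (by positivity)]
  gcongr
  have : y ^ 2 ≤ (1 / m) ^ 2 := by gcongr
  rw [abs_le]
  constructor <;> nlinarith

/-- On `[m, m + 1]` the kernel is its value at the node, plus a slope error, plus the Taylor
remainder of the power. The last two are `O(m^(-1-α))`, so any rate `γ ≤ 1 + α` at the nodes
persists between them. It is applied with `γ = α` for `p = 1` and `γ = 1 + α` otherwise. -/
theorem exists_abs_linearKernel_le {α C γ : ℝ} (hα₀ : 0 < α) (hα₁ : α < 1) (hC : 0 < C)
    (hγ₀ : 0 ≤ γ) (hγ₁ : γ ≤ 1 + α) {V : ℕ → ℝ} (hV : V 0 = 0)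
    (hW : ∀ n : ℕ, |V (n + 2) - V (n + 1) - ((n : ℝ) + 1) ^ (-α) / Real.Gamma (1 - α)|
        ≤ C * ((n : ℝ) + 1) ^ (-1 - α))
    (hVγ : ∀ n : ℕ, |V (n + 1) - ((n : ℝ) + 1) ^ (1 - α) / Real.Gamma (2 - α)|
        ≤ C * ((n : ℝ) + 1) ^ (-γ)) :
    ∃ D : ℝ, 0 < D ∧ ∀ x : ℝ, 0 ≤ x → |linearKernel α V x| ≤ D * (1 + x) ^ (-γ) := by
  have hΓ : 0 < Real.Gamma (1 - α) := Real.Gamma_pos_of_pos (by linarith)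
  have hΓ2 : 0 < Real.Gamma (2 - α) := Real.Gamma_pos_of_pos (by linarith)
  have hΓe : Real.Gamma (2 - α) = (1 - α) * Real.Gamma (1 - α) := by
    rw [← Real.Gamma_add_one (by linarith)]
    congr 1
    ring
  have h1α : 1 - α ≠ 0 := by linarith
  set G := 1 / Real.Gamma (2 - α) with hG
  have hG0 : 0 < G := by positivity
  set D := 9 * (2 * C + G) + 4 * |V 1|
  refine ⟨D, by positivity, fun x hx => ?_⟩
  rcases lt_or_ge x 1 with h1 | h1
  · have hle : x ^ (1 - α) ≤ 1 := Real.rpow_le_one hx h1.le (by linarith)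
    have hge : 0 ≤ x ^ (1 - α) := by positivity
    have h4 : (1 : ℝ) ^ (-γ) ≤ 2 ^ 2 * (1 + x) ^ (-γ) :=
      rpow_neg_le_of_le_mul one_pos (by linarith) (by norm_num) hγ₀ (by linarith) (by linarith)
    rw [Real.one_rpow] at h4
    rw [linearKernel, linearInterp_of_mem (m := 0) (by simpa using hx) (by simpa using h1.le), hV]
    calc _ ≤ |x ^ (1 - α) / Real.Gamma (2 - α)| + |0 + (x - ((0 : ℕ) : ℝ)) * (V (0 + 1) - 0)| :=
          abs_sub _ _
      _ ≤ G + |V 1| := by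
          rw [abs_of_nonneg (by positivity), hG]
          refine add_le_add (by gcongr) ?_
          simp only [Nat.cast_zero, sub_zero, zero_add, abs_mul, abs_of_nonneg hx]
          exact mul_le_of_le_one_left (abs_nonneg _) h1.le
      _ ≤ (G + |V 1|) * (2 ^ 2 * (1 + x) ^ (-γ)) := le_mul_of_one_le_right (by positivity) h4
      _ = (4 * G + 4 * |V 1|) * (1 + x) ^ (-γ) := by ring
      _ ≤ _ := by
          gcongr
          simp only [D]
          linarith
  · obtain ⟨k, hk⟩ : ∃ k, ⌊x⌋₊ = k + 1 :=
      ⟨⌊x⌋₊ - 1, by have := (Nat.one_le_floor_iff x).2 h1; omega⟩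
    have hm1 : ((k : ℝ) + 1) ≤ x := by
      have := Nat.floor_le hx
      rw [hk] at this
      exact_mod_cast this
    have hm2 : x < (k : ℝ) + 1 + 1 := by
      have := Nat.lt_floor_add_one x
      rw [hk] at this
      exact_mod_cast this
    have hk0 : (0 : ℝ) ≤ k := Nat.cast_nonneg k
    have b1 := hW k
    have b2 := hVγ k
    have b3 := abs_rpow_one_sub_sub_le hα₀ hα₁ (by positivity : 0 < (k : ℝ) + 1) hm1 hm2.le
    have b4 : ((k : ℝ) + 1) ^ (-γ) ≤ 3 ^ 2 * (1 + x) ^ (-γ) :=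
      rpow_neg_le_of_le_mul (by positivity) (by positivity) (by norm_num) hγ₀ (by linarith)
        (by linarith)
    have b5 : ((k : ℝ) + 1) ^ (-1 - α) ≤ ((k : ℝ) + 1) ^ (-γ) :=
      Real.rpow_le_rpow_of_exponent_le (by linarith) (by linarith)
    rw [linearKernel, linearInterp_of_mem (m := k + 1) (by exact_mod_cast hm1)
      (by push_cast; linarith)]
    push_cast
    set m : ℝ := (k : ℝ) + 1
    have e : x ^ (1 - α) / Real.Gamma (2 - α)
          - (V (k + 1) + (x - m) * (V (k + 1 + 1) - V (k + 1)))
        = G * (x ^ (1 - α) - m ^ (1 - α) - (1 - α) * (x - m) * m ^ (-α))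
          - ((V (k + 1) - m ^ (1 - α) / Real.Gamma (2 - α))
          + (x - m) * (V (k + 2) - V (k + 1) - m ^ (-α) / Real.Gamma (1 - α))) := by
      rw [hG, hΓe]
      field_simp
      ring
    rw [e]
    have c1 : |G * (x ^ (1 - α) - m ^ (1 - α) - (1 - α) * (x - m) * m ^ (-α))|
        ≤ G * m ^ (-γ) := by
      rw [abs_mul, abs_of_pos hG0]
      gcongr
      exact b3.trans b5
    have c2 : |(x - m) * (V (k + 2) - V (k + 1) - m ^ (-α) / Real.Gamma (1 - α))|
        ≤ C * m ^ (-γ) := by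
      rw [abs_mul, abs_of_nonneg (by linarith : 0 ≤ x - m)]
      calc _ ≤ 1 * (C * m ^ (-1 - α)) := by
            gcongr
            linarith
        _ ≤ C * m ^ (-γ) := by rw [one_mul]; gcongr
    calc _ ≤ G * m ^ (-γ) + (C * m ^ (-γ) + C * m ^ (-γ)) :=
          (abs_sub _ _).trans (add_le_add c1 ((abs_add_le _ _).trans (add_le_add b2 c2)))
      _ = (2 * C + G) * m ^ (-γ) := by ring
      _ ≤ (2 * C + G) * (3 ^ 2 * (1 + x) ^ (-γ)) := by gcongr
      _ = 9 * (2 * C + G) * (1 + x) ^ (-γ) := by ring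
      _ ≤ _ := by
          gcongr
          exact le_add_of_nonneg_right (by positivity)

end

/-! ### Integral representations of the truncation error -/

section

open Filter Topology MeasureTheory

/-- Summation by parts for a discrete convolution. -/
theorem sum_smul_eq_sum_partialSum_smul {E : Type*} [AddCommGroup E] [Module ℝ E]
    (w : ℕ → ℝ) (n : ℕ) :
    ∀ v : ℕ → E, v 0 = 0 → ∑ j ∈ Finset.range (n + 1), w (n - j) • v j
      = ∑ j ∈ Finset.range n, (∑ i ∈ Finset.range (n - j), w i) • (v (j + 1) - v j) := by
  induction n with
  | zero => intro v hv; simp [hv]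
  | succ n ih =>
    intro v hv
    -- The shifted sequence has to vanish at `0` again; the subtracted `v 1` supplies the missing
    -- first increment.
    have h := ih (fun j => v (j + 1) - v 1) (by simp)
    simp only [sub_sub_sub_cancel_right] at h
    rw [Finset.sum_range_succ', hv, smul_zero, add_zero]
    rw [Finset.sum_range_succ' (fun j => (∑ i ∈ Finset.range (n + 1 - j), w i) • (v (j + 1) - v j))]
    simp only [Nat.add_sub_add_right, tsub_zero, zero_add, hv, sub_zero]
    rw [← h, ← Finset.sum_range_reflect w (n + 1), Finset.sum_smul, ← Finset.sum_add_distrib]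
    refine Finset.sum_congr rfl fun j _ => ?_
    rw [Nat.add_sub_cancel, ← smul_add, sub_add_cancel]

/-- The larger of `x` and `y` is at least `N / 2`. This decouples the singularities of a
convolution, for integrals and sums alike. -/
theorem rpow_neg_mul_rpow_neg_le {x y N a b : ℝ} (hx : 0 < x) (hy : 0 < y) (hN : 0 < N)
    (h : N ≤ x + y) (ha : 0 ≤ a) (hb : 0 ≤ b) :
    x ^ (-a) * y ^ (-b) ≤ (N / 2) ^ (-a) * y ^ (-b) + (N / 2) ^ (-b) * x ^ (-a) := by
  have p1 : 0 ≤ (N / 2) ^ (-a) * y ^ (-b) := by positivity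
  have p2 : 0 ≤ (N / 2) ^ (-b) * x ^ (-a) := by positivity
  rcases le_total x y with hxy | hxy
  · have : y ^ (-b) ≤ (N / 2) ^ (-b) :=
      Real.rpow_le_rpow_of_nonpos (by positivity) (by linarith) (by linarith)
    have := mul_le_mul_of_nonneg_left this (by positivity : 0 ≤ x ^ (-a))
    linarith
  · have : x ^ (-a) ≤ (N / 2) ^ (-a) :=
      Real.rpow_le_rpow_of_nonpos (by positivity) (by linarith) (by linarith)
    have := mul_le_mul_of_nonneg_right this (by positivity : 0 ≤ y ^ (-b))
    linarith

theorem intervalIntegrable_sub_rpow {r : ℝ} (hr : -1 < r) (n a b : ℝ) :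
    IntervalIntegrable (fun s : ℝ => (n - s) ^ r) volume a b := by
  have h := (intervalIntegral.intervalIntegrable_rpow' hr (a := n - a) (b := n - b)).comp_sub_left n
  simpa using h

theorem intervalIntegrable_of_norm_le_Ioo {E : Type*} [NormedAddCommGroup E] {F : ℝ → E} {g : ℝ → ℝ}
    {a b : ℝ} (hab : a ≤ b)
    (hF : AEStronglyMeasurable F (volume.restrict (Set.Ioo a b)))
    (hg : IntervalIntegrable g volume a b) (h : ∀ t ∈ Set.Ioo a b, ‖F t‖ ≤ g t) :
    IntervalIntegrable F volume a b := by
  rw [intervalIntegrable_iff_integrableOn_Ioo_of_le hab] at hg ⊢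
  exact Integrable.mono' hg hF ((ae_restrict_iff' measurableSet_Ioo).2 (Eventually.of_forall h))

/-- The regularity of a function rescaled to step size one, on the interval `[0, N]`; the functions
`v₁` and `v₂` are the derivatives of `v`. -/
structure RescaledRegularity {E : Type*} [NormedAddCommGroup E] [NormedSpace ℝ E]
    (α N M : ℝ) (v v₁ v₂ : ℝ → E) : Prop where
  initial : v 0 = 0
  continuousOn : ContinuousOn v (Set.Icc 0 N)
  hasDerivAt : ∀ t ∈ Set.Ioo 0 N, HasDerivAt v (v₁ t) t
  continuousOn_deriv : ContinuousOn v₁ (Set.Ioc 0 N)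
  hasDerivAt_deriv : ∀ t ∈ Set.Ioo 0 N, HasDerivAt v₁ (v₂ t) t
  continuousOn_deriv₂ : ContinuousOn v₂ (Set.Ioo 0 N)
  norm_deriv_le : ∀ t ∈ Set.Ioo 0 N, ‖v₁ t‖ ≤ M * t ^ (α - 1)
  norm_deriv₂_le : ∀ t ∈ Set.Ioo 0 N, ‖v₂ t‖ ≤ M * t ^ (α - 2)

section

variable {E : Type*} [NormedAddCommGroup E] [NormedSpace ℝ E] {α M : ℝ} {v v₁ v₂ : ℝ → E}

theorem norm_integral_le_of_norm_le_Ioo {F : ℝ → E} {g : ℝ → ℝ} {a b : ℝ} (hab : a ≤ b)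
    (hg : IntervalIntegrable g volume a b) (h : ∀ t ∈ Set.Ioo a b, ‖F t‖ ≤ g t) :
    ‖∫ t in a..b, F t‖ ≤ ∫ t in a..b, g t := by
  rw [intervalIntegral.integral_of_le hab, intervalIntegral.integral_of_le hab,
    integral_Ioc_eq_integral_Ioo, integral_Ioc_eq_integral_Ioo]
  refine norm_integral_le_of_norm_le ?_
    ((ae_restrict_iff' measurableSet_Ioo).2 (Eventually.of_forall h))
  rwa [intervalIntegrable_iff_integrableOn_Ioo_of_le hab] at hg

/-- The integrand is dominated by the Beta-type product `(N - s)^(-α) s^(α-1)`, with both exponents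
above `-1`. -/
theorem RescaledRegularity.intervalIntegrable_smul {N : ℝ} (hN : 0 < N) (hα₀ : 0 < α) (hα₁ : α < 1)
    (h : RescaledRegularity α N M v v₁ v₂) {k : ℝ → ℝ} (hk : Measurable k) {D : ℝ} (hD : 0 ≤ D)
    (hkD : ∀ x ∈ Set.Ioo 0 N, |k x| ≤ D * x ^ (-α)) :
    IntervalIntegrable (fun s => k (N - s) • v₁ s) volume 0 N := by
  have hM : 0 ≤ M := by
    have h1 := h.norm_deriv_le (N / 2) ⟨by linarith, by linarith⟩
    have h2 : 0 < (N / 2) ^ (α - 1) := by positivity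
    by_contra hneg
    have := mul_neg_of_neg_of_pos (not_le.1 hneg) h2
    linarith [norm_nonneg (v₁ (N / 2))]
  have hg : IntervalIntegrable (fun s : ℝ => D * M * ((N / 2) ^ (-α) * s ^ (α - 1)
      + (N / 2) ^ (-(1 - α)) * (N - s) ^ (-α))) volume 0 N :=
    (((intervalIntegral.intervalIntegrable_rpow' (by linarith)).const_mul _).add
      ((intervalIntegrable_sub_rpow (by linarith) N 0 N).const_mul _)).const_mul _
  refine intervalIntegrable_of_norm_le_Ioo hN.le ?_ hg fun t ht => ?_
  · refine AEStronglyMeasurable.smul ?_ ?_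
    · exact (hk.comp (measurable_const.sub measurable_id)).aestronglyMeasurable
    · exact (h.continuousOn_deriv.mono Set.Ioo_subset_Ioc_self).aestronglyMeasurable
        measurableSet_Ioo
  · rw [norm_smul, Real.norm_eq_abs]
    have hb := rpow_neg_mul_rpow_neg_le (x := N - t) (y := t) (N := N) (a := α) (b := 1 - α)
      (by linarith [ht.2]) ht.1 hN (by linarith) hα₀.le (by linarith)
    rw [show -(1 - α) = α - 1 by ring] at hb ⊢
    calc |k (N - t)| * ‖v₁ t‖ ≤ (D * (N - t) ^ (-α)) * (M * t ^ (α - 1)) := by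
          have : 0 ≤ N - t := by linarith [ht.2]
          gcongr
          · exact hkD _ ⟨by linarith [ht.2], by linarith [ht.1]⟩
          · exact h.norm_deriv_le t ht
      _ = D * M * ((N - t) ^ (-α) * t ^ (α - 1)) := by ring
      _ ≤ _ := by gcongr

/-- The truncation error for step size one as an integral against the first derivative. -/
theorem RescaledRegularity.truncationError_eq_integral [CompleteSpace E] (hα₀ : 0 < α)
    (hα₁ : α < 1) {n : ℕ} (hn : 1 ≤ n) (h : RescaledRegularity α n M v v₁ v₂) {V w : ℕ → ℝ}
    (hw : ∀ m : ℕ, ∑ i ∈ Finset.range (m + 1), w i = V (m + 1) - V m)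
    {D : ℝ} (hD : 0 ≤ D) (hS : ∀ x : ℝ, 0 < x → |stepKernel α V x| ≤ D * x ^ (-α)) :
    (Real.Gamma (1 - α))⁻¹ • (∫ s in (0 : ℝ)..n, ((n : ℝ) - s) ^ (-α) • v₁ s)
      - ∑ j ∈ Finset.range (n + 1), w (n - j) • v j
      = ∫ s in (0 : ℝ)..n, stepKernel α V (n - s) • v₁ s := by
  have hn0 : (0 : ℝ) < n := by exact_mod_cast hn
  have hI1 : IntervalIntegrable (fun s => ((n : ℝ) - s) ^ (-α) • v₁ s) volume 0 n :=
    h.intervalIntegrable_smul hn0 hα₀ hα₁ (k := fun x => x ^ (-α)) (measurable_id.pow_const _)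
      zero_le_one fun x hx => by
        rw [abs_of_pos (Real.rpow_pos_of_pos hx.1 _), one_mul]
  have hI2 : IntervalIntegrable (fun s => stepKernel α V ((n : ℝ) - s) • v₁ s) volume 0 n :=
    h.intervalIntegrable_smul hn0 hα₀ hα₁ (measurable_stepKernel α V) hD fun x hx => hS x hx.1
  set W : ℝ → ℝ := fun x => V (⌊x⌋₊ + 1) - V ⌊x⌋₊
  have hW : ∀ s : ℝ, W ((n : ℝ) - s) • v₁ s = (Real.Gamma (1 - α))⁻¹ • (((n : ℝ) - s) ^ (-α) • v₁ s)
      - stepKernel α V ((n : ℝ) - s) • v₁ s := by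
    intro s
    rw [smul_smul, ← sub_smul, stepKernel]
    congr 1
    simp only [W]
    ring
  have hI3 : IntervalIntegrable (fun s => W ((n : ℝ) - s) • v₁ s) volume 0 n := by
    simp only [hW]
    exact (hI1.smul _).sub hI2
  have hsum : ∑ j ∈ Finset.range (n + 1), w (n - j) • v j
      = ∫ s in (0 : ℝ)..n, W ((n : ℝ) - s) • v₁ s := by
    rw [sum_smul_eq_sum_partialSum_smul w n (fun j : ℕ => v j) (by simpa using h.initial)]
    have hsub : ∀ k < n, Set.uIcc (k : ℝ) ((k + 1 : ℕ) : ℝ) ⊆ Set.uIcc (0 : ℝ) n := by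
      intro k hk
      have : ((k + 1 : ℕ) : ℝ) ≤ n := by exact_mod_cast hk
      rw [Set.uIcc_of_le (by push_cast; linarith), Set.uIcc_of_le hn0.le]
      exact Set.Icc_subset_Icc (Nat.cast_nonneg k) this
    have hadj := intervalIntegral.sum_integral_adjacent_intervals (a := fun k : ℕ => (k : ℝ))
      (n := n) (μ := volume) fun k hk => hI3.mono_set (hsub k hk)
    rw [Nat.cast_zero] at hadj
    rw [← hadj]
    refine Finset.sum_congr rfl fun j hj => ?_
    have hj := Finset.mem_range.1 hj
    have hjn : ((j : ℝ) + 1) ≤ n := by exact_mod_cast hj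
    obtain ⟨m, hm⟩ : ∃ m, n = j + 1 + m := Nat.exists_eq_add_of_le hj
    have hmr : (n : ℝ) = j + 1 + m := by rw [hm]; push_cast; ring
    have hj0 : (0 : ℝ) ≤ j := Nat.cast_nonneg j
    have hv1 : IntervalIntegrable v₁ volume 0 n := by
      have := h.intervalIntegrable_smul hn0 hα₀ hα₁ (k := fun _ => (1 : ℝ)) measurable_const
        (D := (n : ℝ) ^ α) (by positivity) fun x hx => by
          rw [abs_one, Real.rpow_neg hx.1.le, ← div_eq_mul_inv,
            one_le_div (Real.rpow_pos_of_pos hx.1 _)]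
          exact Real.rpow_le_rpow hx.1.le hx.2.le hα₀.le
      simpa using this
    have hFTC : ∫ s in (j : ℝ)..((j + 1 : ℕ) : ℝ), v₁ s = v ((j + 1 : ℕ) : ℝ) - v j := by
      refine intervalIntegral.integral_eq_sub_of_hasDerivAt_of_le (by push_cast; linarith)
        (h.continuousOn.mono ?_) (fun x hx => h.hasDerivAt x ?_) (hv1.mono_set (hsub j hj))
      · exact Set.Icc_subset_Icc hj0 (by exact_mod_cast hj)
      · push_cast at hx
        exact ⟨by linarith [hx.1], by linarith [hx.2]⟩
    rw [← hFTC, ← intervalIntegral.integral_smul]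
    refine intervalIntegral.integral_congr_ae ?_
    have hne : ∀ᵐ s : ℝ, s ≠ ((j + 1 : ℕ) : ℝ) := by simp [ae_iff]
    filter_upwards [hne] with s hs hmem
    rw [Set.uIoc_of_le (by push_cast; linarith)] at hmem
    have hs2 : s < (j : ℝ) + 1 := by
      have := lt_of_le_of_ne hmem.2 hs
      push_cast at this
      exact this
    -- For `j < s < j + 1` the step function takes its value at `m = n - j - 1`, which is the sum of
    -- the first `n - j` weights.
    have hfl : ⌊(n : ℝ) - s⌋₊ = m :=
      (Nat.floor_eq_iff (by linarith)).2 ⟨by linarith, by linarith [hmem.1]⟩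
    simp only [W]
    rw [hfl, show n - j = m + 1 by omega, hw]
  have hI1' : IntervalIntegrable
      (fun s => (Real.Gamma (1 - α))⁻¹ • (((n : ℝ) - s) ^ (-α) • v₁ s)) volume 0 n := hI1.smul _
  rw [hsum, ← intervalIntegral.integral_smul, ← intervalIntegral.integral_sub hI1' hI3]
  refine intervalIntegral.integral_congr fun s _ => ?_
  simp only [hW]
  abel

/-- Integration by parts on `[m, n]`. -/
theorem RescaledRegularity.integral_stepKernel_eq [CompleteSpace E] (hα₁ : α < 1) {n : ℕ}
    (h : RescaledRegularity α n M v v₁ v₂) {V : ℕ → ℝ} (hV : V 0 = 0) {m : ℝ} (hm : 0 < m)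
    (hmn : m ≤ n)
    (hI : IntervalIntegrable (fun s => stepKernel α V ((n : ℝ) - s) • v₁ s) volume m n)
    (hK : IntervalIntegrable (fun s => linearKernel α V ((n : ℝ) - s) • v₂ s) volume m n) :
    ∫ s in m..n, stepKernel α V (n - s) • v₁ s
      = linearKernel α V (n - m) • v₁ m + ∫ s in m..n, linearKernel α V (n - s) • v₂ s := by
  set f : ℝ → E := fun s => linearKernel α V (n - s) • v₁ s
  set f' : ℝ → E := fun s => linearKernel α V (n - s) • v₂ s - stepKernel α V (n - s) • v₁ s
  have hc : ContinuousOn f (Set.Icc m n) := by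
    refine ContinuousOn.smul ?_ (h.continuousOn_deriv.mono fun s hs => ⟨by linarith [hs.1], hs.2⟩)
    refine (continuousOn_linearKernel hα₁ V n).comp (by fun_prop) fun s hs => ?_
    exact ⟨by linarith [hs.2], by linarith [hs.1]⟩
  -- The kernel has corners at the integers, so differentiability may fail at countably many `s`;
  -- continuity suffices there.
  have hcount : (Set.range fun k : ℕ => (n : ℝ) - k).Countable := Set.countable_range _
  have hd : ∀ s ∈ Set.Ioo m n \ Set.range (fun k : ℕ => (n : ℝ) - k), HasDerivAt f (f' s) s := by
    intro s hs
    have hs0 : s ∈ Set.Ioo (0 : ℝ) n := ⟨by linarith [hs.1.1], hs.1.2⟩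
    have hk := hasDerivAt_linearKernel hα₁ V (x := (n : ℝ) - s) (by linarith [hs.1.2])
      fun heq => hs.2 ⟨⌊(n : ℝ) - s⌋₊, by simp only; linarith⟩
    have hk' := hk.comp s ((hasDerivAt_id s).const_sub (n : ℝ))
    have := hk'.smul (h.hasDerivAt_deriv s hs0)
    convert! this using 1
    simp only [f', Function.comp_apply]
    rw [mul_neg_one, neg_smul, sub_eq_add_neg]
  have hint := integral_eq_of_hasDerivAt_off_countable_of_le f f' hmn hcount hc hd (hK.sub hI)
  simp only [f', f] at hint
  rw [intervalIntegral.integral_sub hK hI, sub_self, linearKernel_zero hα₁ hV, zero_smul,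
    zero_sub] at hint
  rw [sub_eq_iff_eq_add] at hint
  rw [hint]
  abel

/-- Splitting of the truncation error at `m`: the first derivative is used to the left of `m` and
the second one to the right. -/
theorem RescaledRegularity.norm_integral_stepKernel_le [CompleteSpace E] (hα₀ : 0 < α)
    (hα₁ : α < 1) {n : ℕ} (h : RescaledRegularity α n M v v₁ v₂) {V : ℕ → ℝ}
    (hV : V 0 = 0) {D : ℝ} (hD : 0 ≤ D)
    (hS : ∀ x : ℝ, 0 < x → |stepKernel α V x| ≤ D * x ^ (-α))
    (hS' : ∀ x : ℝ, 0 < x → |stepKernel α V x| ≤ D * x ^ (-1 - α)) {m : ℝ} (hm : 0 < m)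
    (hmn : m ≤ n / 2) {k : ℝ → ℝ} (hk : ∀ x ∈ Set.Ioc 0 (n - m), |linearKernel α V x| ≤ k x)
    (hkI : IntervalIntegrable (fun s => k (n - s) * s ^ (α - 2)) volume m n) :
    ‖∫ s in (0 : ℝ)..n, stepKernel α V (n - s) • v₁ s‖
      ≤ M * (D / α * ((n : ℝ) / 2) ^ (-1 - α) * m ^ α + k (n - m) * m ^ (α - 1)
        + ∫ s in m..n, k (n - s) * s ^ (α - 2)) := by
  have hn0 : (0 : ℝ) < n := by linarith
  have hmn' : m < n := by linarith
  have hI : IntervalIntegrable (fun s => stepKernel α V ((n : ℝ) - s) • v₁ s) volume 0 n :=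
    h.intervalIntegrable_smul hn0 hα₀ hα₁ (measurable_stepKernel α V) hD fun x hx => hS x hx.1
  have hI1 := hI.mono_set (c := 0) (d := m) (by
    rw [Set.uIcc_of_le hm.le, Set.uIcc_of_le hn0.le]; exact Set.Icc_subset_Icc le_rfl hmn'.le)
  have hI2 := hI.mono_set (c := m) (d := n) (by
    rw [Set.uIcc_of_le hmn'.le, Set.uIcc_of_le hn0.le]; exact Set.Icc_subset_Icc hm.le le_rfl)
  have hKb : ∀ s ∈ Set.Ioo m n, ‖linearKernel α V ((n : ℝ) - s) • v₂ s‖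
      ≤ M * (k (n - s) * s ^ (α - 2)) := by
    intro s hs
    have h1 := hk ((n : ℝ) - s) ⟨by linarith [hs.2], by linarith [hs.1]⟩
    rw [norm_smul, Real.norm_eq_abs]
    calc _ ≤ k (n - s) * (M * s ^ (α - 2)) := by
          gcongr
          · exact (abs_nonneg _).trans h1
          · exact h.norm_deriv₂_le s ⟨by linarith [hs.1], hs.2⟩
      _ = _ := by ring
  have hK : IntervalIntegrable (fun s => linearKernel α V ((n : ℝ) - s) • v₂ s) volume m n := by
    refine intervalIntegrable_of_norm_le_Ioo hmn'.le ?_ (hkI.const_mul M) hKb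
    refine ContinuousOn.aestronglyMeasurable (ContinuousOn.smul ?_ ?_) measurableSet_Ioo
    · refine (continuousOn_linearKernel hα₁ V n).comp (by fun_prop) fun s hs => ?_
      exact ⟨by linarith [hs.2], by linarith [hs.1]⟩
    · exact h.continuousOn_deriv₂.mono fun s hs => ⟨by linarith [hs.1], hs.2⟩
  rw [← intervalIntegral.integral_add_adjacent_intervals hI1 hI2,
    h.integral_stepKernel_eq hα₁ hV hm hmn'.le hI2 hK]
  -- Here `n - s ≥ n / 2`, so the kernel is small, while `s^(α-1)` is integrable at `0`.
  have b1 : ‖∫ s in (0 : ℝ)..m, stepKernel α V (n - s) • v₁ s‖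
      ≤ M * (D / α * ((n : ℝ) / 2) ^ (-1 - α) * m ^ α) := by
    have hg : IntervalIntegrable (fun s : ℝ => D * ((n : ℝ) / 2) ^ (-1 - α) * M * s ^ (α - 1))
        volume 0 m := (intervalIntegral.intervalIntegrable_rpow' (by linarith)).const_mul _
    refine (norm_integral_le_of_norm_le_Ioo hm.le hg fun s hs => ?_).trans_eq ?_
    · rw [norm_smul, Real.norm_eq_abs]
      have hsn : (n : ℝ) / 2 ≤ n - s := by linarith [hs.2]
      calc _ ≤ (D * ((n : ℝ) / 2) ^ (-1 - α)) * (M * s ^ (α - 1)) := by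
            gcongr
            · refine (hS' _ (by linarith)).trans ?_
              gcongr D * ?_
              exact Real.rpow_le_rpow_of_nonpos (by linarith) hsn (by linarith)
            · exact h.norm_deriv_le s ⟨hs.1, by linarith [hs.2]⟩
        _ = _ := by ring
    · rw [intervalIntegral.integral_const_mul, integral_rpow (Or.inl (by linarith)),
        sub_add_cancel, Real.zero_rpow hα₀.ne', sub_zero]
      ring
  have b2 : ‖linearKernel α V (n - m) • v₁ m‖ ≤ M * (k (n - m) * m ^ (α - 1)) := by
    have h1 := hk ((n : ℝ) - m) ⟨by linarith, le_rfl⟩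
    rw [norm_smul, Real.norm_eq_abs]
    calc _ ≤ k (n - m) * (M * m ^ (α - 1)) := by
          gcongr
          · exact (abs_nonneg _).trans h1
          · exact h.norm_deriv_le m ⟨hm, hmn'⟩
      _ = _ := by ring
  have b3 : ‖∫ s in m..n, linearKernel α V (n - s) • v₂ s‖
      ≤ M * ∫ s in m..n, k (n - s) * s ^ (α - 2) := by
    rw [← intervalIntegral.integral_const_mul]
    exact norm_integral_le_of_norm_le_Ioo hmn'.le (hkI.const_mul M) hKb
  calc _ ≤ _ := norm_add_le _ _
    _ ≤ _ := add_le_add_right (norm_add_le _ _) _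
    _ ≤ M * (D / α * ((n : ℝ) / 2) ^ (-1 - α) * m ^ α) + (M * (k (n - m) * m ^ (α - 1))
        + M * ∫ s in m..n, k (n - s) * s ^ (α - 2)) := by gcongr
    _ = _ := by ring

end

end

/-! ### Decay of the step-one error -/

section

open Filter Topology MeasureTheory

theorem half_rpow_neg_le_two {r : ℝ} (hr : r ≤ 1) : (1 / 2 : ℝ) ^ (-r) ≤ 2 := by
  rw [Real.rpow_neg (by norm_num), ← Real.inv_rpow (by norm_num)]
  calc ((1 / 2 : ℝ)⁻¹) ^ r ≤ ((1 / 2 : ℝ)⁻¹) ^ (1 : ℝ) :=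
        Real.rpow_le_rpow_of_exponent_le (by norm_num) hr
    _ = 2 := by norm_num

section

variable {E : Type*} [NormedAddCommGroup E] [NormedSpace ℝ E]

/-- Bound for the part of the truncation error with an integrable kernel of order `-1 - α`. -/
theorem integral_shifted_kernel_le {α D : ℝ} (hα₀ : 0 < α) (hα₁ : α < 1) (hD : 0 ≤ D) {n : ℝ}
    (hn : 1 ≤ n) :
    IntervalIntegrable (fun s : ℝ => D * (1 + (n - s)) ^ (-(1 + α)) * s ^ (α - 2))
      volume (1 / 2) n ∧
    ∫ s in (1 / 2 : ℝ)..n, D * (1 + (n - s)) ^ (-(1 + α)) * s ^ (α - 2)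
      ≤ D * ((n / 2) ^ (-(1 + α)) * (2 / (1 - α)) + (n / 2) ^ (-(2 - α)) * (1 / α)) := by
  have hle : (1 / 2 : ℝ) ≤ n := by linarith
  have c1 : ContinuousOn (fun s : ℝ => (1 + (n - s)) ^ (-(1 + α))) (Set.uIcc (1 / 2) n) := by
    rw [Set.uIcc_of_le hle]
    refine ContinuousOn.rpow_const (by fun_prop) fun s hs => Or.inl ?_
    have := hs.2
    linarith
  have c2 : ContinuousOn (fun s : ℝ => s ^ (α - 2)) (Set.uIcc (1 / 2) n) := by
    rw [Set.uIcc_of_le hle]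
    refine ContinuousOn.rpow_const (by fun_prop) fun s hs => Or.inl ?_
    have := hs.1
    linarith
  have hI := ((c1.const_mul D).mul c2).intervalIntegrable (μ := volume)
  refine ⟨hI, ?_⟩
  have hJ : IntervalIntegrable (fun s : ℝ => D * ((n / 2) ^ (-(1 + α)) * s ^ (α - 2)
      + (n / 2) ^ (-(2 - α)) * (1 + (n - s)) ^ (-(1 + α)))) volume (1 / 2) n :=
    (((c2.const_mul _).add (c1.const_mul _)).const_mul D).intervalIntegrable
  have i1 : ∫ s in (1 / 2 : ℝ)..n, s ^ (α - 2) ≤ 2 / (1 - α) := by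
    have h0 : (0 : ℝ) ∉ Set.uIcc (1 / 2 : ℝ) n := by
      rw [Set.uIcc_of_le hle]
      intro h
      linarith [h.1]
    rw [integral_rpow (Or.inr ⟨by linarith, h0⟩), show α - 2 + 1 = -(1 - α) by ring, div_neg,
      ← neg_div, neg_sub]
    refine div_le_div_of_nonneg_right ?_ (by linarith)
    have h1 : (1 / 2 : ℝ) ^ (-(1 - α)) ≤ 2 := half_rpow_neg_le_two (by linarith)
    have h2 : 0 < n ^ (-(1 - α)) := by positivity
    linarith
  have i2 : ∫ s in (1 / 2 : ℝ)..n, (1 + (n - s)) ^ (-(1 + α)) ≤ 1 / α := by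
    have e : ∀ s : ℝ, (1 + (n - s)) ^ (-(1 + α)) = (1 + n - s) ^ (-(1 + α)) := fun s => by ring_nf
    simp only [e]
    rw [intervalIntegral.integral_comp_sub_left (fun x : ℝ => x ^ (-(1 + α))) (1 + n)]
    have h0 : (0 : ℝ) ∉ Set.uIcc (1 + n - n) (1 + n - 1 / 2) := by
      rw [Set.uIcc_of_le (by linarith)]
      intro h
      linarith [h.1]
    rw [integral_rpow (Or.inr ⟨by linarith, h0⟩), show -(1 + α) + 1 = -α by ring, div_neg,
      ← neg_div, neg_sub, add_sub_cancel_right, Real.one_rpow]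
    refine div_le_div_of_nonneg_right ?_ hα₀.le
    have : 0 < (1 + n - 1 / 2) ^ (-α) := Real.rpow_pos_of_pos (by linarith) _
    linarith
  calc ∫ s in (1 / 2 : ℝ)..n, D * (1 + (n - s)) ^ (-(1 + α)) * s ^ (α - 2)
      ≤ ∫ s in (1 / 2 : ℝ)..n, D * ((n / 2) ^ (-(1 + α)) * s ^ (α - 2)
          + (n / 2) ^ (-(2 - α)) * (1 + (n - s)) ^ (-(1 + α))) := by
        refine intervalIntegral.integral_mono_on hle hI hJ fun s hs => ?_
        -- Both exponents exceed `1`, so after decoupling each factor has an integral bounded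
        -- independently of `n`.
        have hb := rpow_neg_mul_rpow_neg_le (x := 1 + (n - s)) (y := s) (N := n) (a := 1 + α)
          (b := 2 - α) (by linarith [hs.2]) (by linarith [hs.1]) (by linarith) (by linarith)
          (by linarith) (by linarith)
        rw [show α - 2 = -(2 - α) by ring, mul_assoc]
        gcongr
    _ = D * ((n / 2) ^ (-(1 + α)) * (∫ s in (1 / 2 : ℝ)..n, s ^ (α - 2))
          + (n / 2) ^ (-(2 - α)) * ∫ s in (1 / 2 : ℝ)..n, (1 + (n - s)) ^ (-(1 + α))) := by
        rw [intervalIntegral.integral_const_mul, intervalIntegral.integral_add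
          (c2.const_mul _).intervalIntegrable (c1.const_mul _).intervalIntegrable,
          intervalIntegral.integral_const_mul, intervalIntegral.integral_const_mul]
    _ ≤ _ := by gcongr

/-- Bound for the part of the truncation error with a kernel of order `-α`. -/
theorem integral_singular_kernel_le {α D : ℝ} (hα₀ : 0 < α) (hα₁ : α < 1) (hD : 0 ≤ D) {n : ℝ}
    (hn : 0 < n) :
    IntervalIntegrable (fun s : ℝ => D * (n - s) ^ (-α) * s ^ (α - 2)) volume (n / 2) n ∧
    ∫ s in (n / 2)..n, D * (n - s) ^ (-α) * s ^ (α - 2) ≤ D / (1 - α) * (n / 2)⁻¹ := by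
  have hle : n / 2 ≤ n := by linarith
  have c2 : ContinuousOn (fun s : ℝ => s ^ (α - 2)) (Set.uIcc (n / 2) n) := by
    rw [Set.uIcc_of_le hle]
    refine ContinuousOn.rpow_const (by fun_prop) fun s hs => Or.inl ?_
    have := hs.1
    linarith
  have h1 : IntervalIntegrable (fun s : ℝ => D * (n - s) ^ (-α)) volume (n / 2) n :=
    (intervalIntegrable_sub_rpow (by linarith) n (n / 2) n).const_mul D
  have hI := h1.mul_continuousOn c2
  refine ⟨hI, ?_⟩
  calc ∫ s in (n / 2)..n, D * (n - s) ^ (-α) * s ^ (α - 2)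
      ≤ ∫ s in (n / 2)..n, D * (n - s) ^ (-α) * (n / 2) ^ (α - 2) := by
        refine intervalIntegral.integral_mono_on hle hI (h1.mul_const _) fun s hs => ?_
        have : 0 ≤ n - s := by linarith [hs.2]
        gcongr ?_ * ?_
        exact Real.rpow_le_rpow_of_nonpos (by linarith) hs.1 (by linarith)
    _ = D / (1 - α) * (n / 2)⁻¹ := by
        rw [intervalIntegral.integral_mul_const, intervalIntegral.integral_const_mul,
          intervalIntegral.integral_comp_sub_left (fun x : ℝ => x ^ (-α)) n, sub_self,
          integral_rpow (Or.inl (by linarith)), Real.zero_rpow (by linarith), sub_zero,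
          show n - n / 2 = n / 2 by ring, show -α + 1 = 1 - α by ring]
        have e : (n / 2) ^ (1 - α) * (n / 2) ^ (α - 2) = (n / 2)⁻¹ := by
          rw [← Real.rpow_add (by positivity), ← Real.rpow_neg_one]
          congr 1
          ring
        rw [← e]
        ring

/-- Decay of the truncation error for step size one. -/
theorem exists_rescaled_error_bound [CompleteSpace E] {p : ℕ} (hp₁ : 1 ≤ p) (hp₆ : p ≤ 6)
    {α : ℝ} (hα₀ : 0 < α) (hα₁ : α < 1) :
    ∃ σ C : ℝ, 0 < C ∧ 1 ≤ σ ∧ σ ≤ 2 ∧ (p ≠ 1 → 1 < σ) ∧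
      ∀ h : ℝ, 0 < h → ∀ n : ℕ, 1 ≤ n → ∀ (M : ℝ) (v v₁ v₂ : ℝ → E),
        RescaledRegularity α n M v v₁ v₂ → 0 ≤ M →
        ‖(Real.Gamma (1 - α))⁻¹ • (∫ s in (0 : ℝ)..n, ((n : ℝ) - s) ^ (-α) • v₁ s)
          - ∑ j ∈ Finset.range (n + 1), (h ^ α * cqWeight p α h (n - j)) • v j‖
          ≤ C * M * (n : ℝ) ^ (-σ) := by
  obtain ⟨V, C, hC, hV0, hVw, hW, hVα, hV2⟩ := exists_cq_sums hp₁ hp₆ hα₀ hα₁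
  obtain ⟨D, hD, hS⟩ := exists_abs_stepKernel_le hα₀ hα₁ hC hV0 hW
  have h1α : 0 < 1 - α := by linarith
  have hrep : ∀ h : ℝ, 0 < h → ∀ n : ℕ, 1 ≤ n → ∀ (M : ℝ) (v v₁ v₂ : ℝ → E),
      RescaledRegularity α n M v v₁ v₂ →
      (Real.Gamma (1 - α))⁻¹ • (∫ s in (0 : ℝ)..n, ((n : ℝ) - s) ^ (-α) • v₁ s)
          - ∑ j ∈ Finset.range (n + 1), (h ^ α * cqWeight p α h (n - j)) • v j
        = ∫ s in (0 : ℝ)..n, stepKernel α V (n - s) • v₁ s := by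
    intro h hh n hn M v v₁ v₂ hr
    refine hr.truncationError_eq_integral hα₀ hα₁ hn (w := fun i => h ^ α * cqWeight p α h i)
      (fun m => ?_) hD.le fun x hx => (hS x hx).2
    rw [← Finset.mul_sum, hVw h hh, ← mul_assoc, ← Real.rpow_add hh, add_neg_cancel,
      Real.rpow_zero, one_mul]
  by_cases hp : p = 1
  -- For `p = 1` the kernel `x^(-α)` is not integrable at infinity. Splitting at `n / 2` balances
  -- all three terms at order `1/n`.
  · obtain ⟨D₂, hD₂, hK⟩ := exists_abs_linearKernel_le hα₀ hα₁ hC hα₀.le (by linarith) hV0 hW hVα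
    refine ⟨1, 2 * (D / α + D₂ + D₂ / (1 - α)), by positivity, le_rfl, by norm_num,
      fun h => absurd hp h, fun h hh n hn M v v₁ v₂ hr hM => ?_⟩
    have hn0 : (0 : ℝ) < n := by exact_mod_cast hn
    rw [hrep h hh n hn M v v₁ v₂ hr]
    obtain ⟨hI, hb⟩ := integral_singular_kernel_le hα₀ hα₁ hD₂.le hn0
    refine (hr.norm_integral_stepKernel_le hα₀ hα₁ hV0 hD.le (fun x hx => (hS x hx).2)
      (fun x hx => (hS x hx).1) (m := n / 2) (by positivity) le_rfl
      (k := fun x => D₂ * x ^ (-α)) (fun x hx => ?_) hI).trans ?_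
    · refine (hK x hx.1.le).trans ?_
      gcongr D₂ * ?_
      exact Real.rpow_le_rpow_of_nonpos hx.1 (by linarith) (by linarith)
    · have e1 : ((n : ℝ) / 2) ^ (-1 - α) * ((n : ℝ) / 2) ^ α = ((n : ℝ) / 2)⁻¹ := by
        rw [← Real.rpow_add (by positivity), ← Real.rpow_neg_one]
        congr 1
        ring
      have e2 : ((n : ℝ) / 2) ^ (-α) * ((n : ℝ) / 2) ^ (α - 1) = ((n : ℝ) / 2)⁻¹ := by
        rw [← Real.rpow_add (by positivity), ← Real.rpow_neg_one]
        congr 1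
        ring
      rw [mul_assoc (D / α), e1, show (n : ℝ) - n / 2 = n / 2 by ring, mul_assoc D₂, e2]
      calc _ ≤ M * (D / α * ((n : ℝ) / 2)⁻¹ + D₂ * ((n : ℝ) / 2)⁻¹
            + D₂ / (1 - α) * ((n : ℝ) / 2)⁻¹) := by gcongr
        _ = _ := by
          rw [Real.rpow_neg_one]
          field_simp
  · have hp2 : 2 ≤ p := by omega
    obtain ⟨D₂, hD₂, hK⟩ := exists_abs_linearKernel_le (γ := 1 + α) hα₀ hα₁ hC (by linarith) le_rfl
      hV0 hW (fun n => by rw [show -(1 + α) = -1 - α by ring]; exact hV2 hp2 n)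
    -- The slower of the two decays: `1 + α` from the kernel and `2 - α` from the second derivative.
    -- It exceeds `1` as `0 < α < 1`.
    set σ := min (1 + α) (2 - α)
    have hσ1 : 1 < σ := lt_min (by linarith) (by linarith)
    have hσ2 : σ ≤ 2 := (min_le_right _ _).trans (by linarith)
    refine ⟨σ, 4 * (D / α + 2 * D₂ + D₂ * (2 / (1 - α) + 1 / α)), by positivity, hσ1.le, hσ2,
      fun _ => hσ1, fun h hh n hn M v v₁ v₂ hr hM => ?_⟩
    have hn1 : (1 : ℝ) ≤ n := by exact_mod_cast hn
    have hn0 : (0 : ℝ) < n := by linarith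
    rw [hrep h hh n hn M v v₁ v₂ hr]
    obtain ⟨hI, hb⟩ := integral_shifted_kernel_le hα₀ hα₁ hD₂.le hn1
    refine (hr.norm_integral_stepKernel_le hα₀ hα₁ hV0 hD.le (fun x hx => (hS x hx).2)
      (fun x hx => (hS x hx).1) (m := 1 / 2) (by positivity) (by linarith)
      (k := fun x => D₂ * (1 + x) ^ (-(1 + α))) (fun x hx => hK x hx.1.le) hI).trans ?_
    have q1 : ((n : ℝ) / 2) ^ (-(1 + α)) ≤ 4 * (n : ℝ) ^ (-σ) := by
      calc ((n : ℝ) / 2) ^ (-(1 + α)) ≤ 2 ^ 2 * (n : ℝ) ^ (-(1 + α)) :=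
            rpow_neg_le_of_le_mul (by positivity) hn0 (by norm_num) (by linarith) (by linarith)
              (by linarith)
        _ ≤ 2 ^ 2 * (n : ℝ) ^ (-σ) := by
            gcongr
            exact min_le_left _ _
        _ = _ := by norm_num
    have q2 : ((n : ℝ) / 2) ^ (-(2 - α)) ≤ 4 * (n : ℝ) ^ (-σ) := by
      calc ((n : ℝ) / 2) ^ (-(2 - α)) ≤ 2 ^ 2 * (n : ℝ) ^ (-(2 - α)) :=
            rpow_neg_le_of_le_mul (by positivity) hn0 (by norm_num) (by linarith) (by linarith)
              (by linarith)
        _ ≤ 2 ^ 2 * (n : ℝ) ^ (-σ) := by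
            gcongr
            exact min_le_right _ _
        _ = _ := by norm_num
    have t1 : D / α * ((n : ℝ) / 2) ^ (-1 - α) * (1 / 2) ^ α ≤ D / α * (4 * (n : ℝ) ^ (-σ)) := by
      rw [show -1 - α = -(1 + α) by ring]
      calc _ ≤ D / α * ((n : ℝ) / 2) ^ (-(1 + α)) * 1 := by
            gcongr
            exact Real.rpow_le_one (by norm_num) (by norm_num) hα₀.le
        _ ≤ _ := by rw [mul_one]; gcongr
    have t2 : D₂ * (1 + ((n : ℝ) - 1 / 2)) ^ (-(1 + α)) * (1 / 2) ^ (α - 1)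
        ≤ 2 * D₂ * (4 * (n : ℝ) ^ (-σ)) := by
      have a1 : (1 + ((n : ℝ) - 1 / 2)) ^ (-(1 + α)) ≤ ((n : ℝ) / 2) ^ (-(1 + α)) :=
        Real.rpow_le_rpow_of_nonpos (by positivity) (by linarith) (by linarith)
      have a2 : (1 / 2 : ℝ) ^ (α - 1) ≤ 2 := by
        rw [show α - 1 = -(1 - α) by ring]
        exact half_rpow_neg_le_two (by linarith)
      calc _ ≤ D₂ * (4 * (n : ℝ) ^ (-σ)) * 2 := by
            gcongr
            exact a1.trans q1
        _ = _ := by ring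
    have t3 : D₂ * (((n : ℝ) / 2) ^ (-(1 + α)) * (2 / (1 - α))
        + ((n : ℝ) / 2) ^ (-(2 - α)) * (1 / α))
        ≤ D₂ * (4 * (n : ℝ) ^ (-σ) * (2 / (1 - α)) + 4 * (n : ℝ) ^ (-σ) * (1 / α)) := by
      gcongr
    calc _ ≤ M * (D / α * (4 * (n : ℝ) ^ (-σ)) + 2 * D₂ * (4 * (n : ℝ) ^ (-σ))
          + D₂ * (4 * (n : ℝ) ^ (-σ) * (2 / (1 - α)) + 4 * (n : ℝ) ^ (-σ) * (1 / α))) := by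
          gcongr
          exact hb.trans t3
      _ = _ := by ring

end

end

/-! ### Rescaling and discrete fractional sums -/

section

open Filter Topology MeasureTheory

section

variable {E : Type*} [NormedAddCommGroup E] [NormedSpace ℝ E] {α T M : ℝ} {u : ℝ → E}

theorem SolutionRegularity.continuousOn_Icc (hα₀ : 0 < α) (h : SolutionRegularity α T M u) :
    ContinuousOn u (Set.Icc 0 T) := by
  have hb : ∀ t ∈ Set.Icc 0 T, ‖u t‖ ≤ M * t ^ α := by
    intro t ht
    rcases ht.1.eq_or_lt with rfl | h0
    · simp [h.initial, Real.zero_rpow hα₀.ne']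
    · simpa using h.bound 0 (by norm_num) t ⟨h0, ht.2⟩
  intro t ht
  rcases ht.1.eq_or_lt with rfl | h0
  · have h1 : Tendsto (fun t : ℝ => M * t ^ α) (𝓝[Set.Icc 0 T] 0) (𝓝 0) := by
      have h2 : Continuous fun t : ℝ => M * t ^ α :=
        continuous_const.mul (Real.continuous_rpow_const hα₀.le)
      have h3 := h2.tendsto 0
      rw [Real.zero_rpow hα₀.ne', mul_zero] at h3
      exact h3.mono_left nhdsWithin_le_nhds
    rw [ContinuousWithinAt, h.initial]
    exact squeeze_zero_norm' (eventually_nhdsWithin_of_forall hb) h1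
  · have h1 := h.contDiffOn.continuousOn t ⟨h0, ht.2⟩
    refine h1.mono_of_mem_nhdsWithin ?_
    filter_upwards [self_mem_nhdsWithin, mem_nhdsWithin_of_mem_nhds (Ioi_mem_nhds h0)] with s hs hs0
    exact ⟨hs0, hs.2⟩

/-- The bounds `t^(α-m)` are homogeneous: the factor `k^m` from the chain rule meets `k^(α-m)`,
leaving `k^α` for every `m`. -/
theorem SolutionRegularity.rescale (hα₀ : 0 < α) (h : SolutionRegularity α T M u) {k : ℝ}
    (hk : 0 < k) {N : ℝ} (hN : N * k ≤ T) :
    RescaledRegularity α N (M * k ^ α) (fun s => u (s * k))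
      (fun s => k • derivWithin u (Set.Ioc 0 T) (s * k))
      (fun s => k ^ 2 • derivWithin (derivWithin u (Set.Ioc 0 T)) (Set.Ioc 0 T) (s * k)) := by
  set I := Set.Ioc 0 T
  have hU : UniqueDiffOn ℝ I := uniqueDiffOn_Ioc 0 T
  have hi1 : iteratedDerivWithin 1 u I = derivWithin u I := iteratedDerivWithin_one
  have hi2 : ∀ t, iteratedDerivWithin 2 u I t = derivWithin (derivWithin u I) I t := by
    intro t
    rw [iteratedDerivWithin_succ, hi1]
  have hnhds : ∀ s ∈ Set.Ioo 0 N, I ∈ 𝓝 (s * k) := fun s hs =>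
    mem_of_superset (Ioo_mem_nhds (mul_pos hs.1 hk)
      (lt_of_lt_of_le (mul_lt_mul_of_pos_right hs.2 hk) hN)) Set.Ioo_subset_Ioc_self
  have hmem : ∀ s ∈ Set.Ioc 0 N, s * k ∈ I := fun s hs =>
    ⟨mul_pos hs.1 hk, (mul_le_mul_of_nonneg_right hs.2 hk.le).trans hN⟩
  have hmul : ∀ s : ℝ, HasDerivAt (fun s : ℝ => s * k) k s := fun s => hasDerivAt_mul_const k
  have hd0 : DifferentiableOn ℝ u I := h.contDiffOn.differentiableOn (by norm_num)
  have hd1 : DifferentiableOn ℝ (derivWithin u I) I := by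
    rw [← hi1]
    exact h.contDiffOn.differentiableOn_iteratedDerivWithin (by norm_num) hU
  have hc2 : ContinuousOn (derivWithin (derivWithin u I) I) I := by
    have := h.contDiffOn.continuousOn_iteratedDerivWithin (m := 2) le_rfl hU
    exact this.congr fun t _ => (hi2 t).symm
  refine ⟨by simpa using h.initial, ?_, ?_, ?_, ?_, ?_, ?_, ?_⟩
  · refine (h.continuousOn_Icc hα₀).comp (by fun_prop) fun s hs => ?_
    exact ⟨mul_nonneg hs.1 hk.le, (mul_le_mul_of_nonneg_right hs.2 hk.le).trans hN⟩
  · intro s hs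
    have h1 := ((hd0 _ (hmem s ⟨hs.1, hs.2.le⟩)).hasDerivWithinAt).hasDerivAt (hnhds s hs)
    exact h1.scomp s (hmul s)
  · exact (hd1.continuousOn.comp (by fun_prop) hmem).const_smul k
  · intro s hs
    have h1 := ((hd1 _ (hmem s ⟨hs.1, hs.2.le⟩)).hasDerivWithinAt).hasDerivAt (hnhds s hs)
    have h2 := (h1.scomp s (hmul s)).const_smul k
    rw [smul_smul, ← pow_two] at h2
    exact h2
  · exact (hc2.comp (by fun_prop) fun s hs => hmem s ⟨hs.1, hs.2.le⟩).const_smul (k ^ 2)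
  · intro s hs
    have h1 := h.bound 1 (by norm_num) (s * k) (hmem s ⟨hs.1, hs.2.le⟩)
    rw [hi1, Real.mul_rpow hs.1.le hk.le, Nat.cast_one, Real.rpow_sub_one hk.ne'] at h1
    rw [norm_smul, Real.norm_of_nonneg hk.le]
    calc _ ≤ k * (M * (s ^ (α - 1) * (k ^ α / k))) := by gcongr
      _ = _ := by field_simp
  · intro s hs
    have h1 := h.bound 2 le_rfl (s * k) (hmem s ⟨hs.1, hs.2.le⟩)
    rw [hi2, Real.mul_rpow hs.1.le hk.le, Real.rpow_sub_natCast hk.ne'] at h1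
    rw [norm_smul, Real.norm_of_nonneg (by positivity)]
    calc _ ≤ k ^ 2 * (M * (s ^ (α - ((2 : ℕ) : ℝ)) * (k ^ α / k ^ 2))) := by gcongr
      _ = _ := by
        push_cast
        field_simp

/-- The truncation error for step size `k` in terms of the function rescaled to step size one. -/
theorem truncationError_eq_rescaled {p : ℕ} {k : ℝ} (hk : 0 < k) {n : ℕ} (hn : (n : ℝ) * k ≤ T) :
    truncationError p α k u n = k ^ (-α) • ((Real.Gamma (1 - α))⁻¹ • (∫ s in (0 : ℝ)..n,
        ((n : ℝ) - s) ^ (-α) • (k • derivWithin u (Set.Ioc 0 T) (s * k)))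
      - ∑ j ∈ Finset.range (n + 1), (k ^ α * cqWeight p α k (n - j)) • u (j * k)) := by
  have hkk : k ^ (-α) * k ^ α = 1 := by
    rw [← Real.rpow_add hk, neg_add_cancel, Real.rpow_zero]
  have hsum : cqDeriv p α k u n = k ^ (-α) •
      ∑ j ∈ Finset.range (n + 1), (k ^ α * cqWeight p α k (n - j)) • u (j * k) := by
    rw [cqDeriv, Finset.smul_sum]
    refine Finset.sum_congr rfl fun j _ => ?_
    rw [smul_smul, ← mul_assoc, hkk, one_mul]
  have hint := intervalIntegral.integral_comp_mul_right (a := 0) (b := n)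
    (fun s => ((n : ℝ) * k - s) ^ (-α) • deriv u s) hk.ne'
  rw [zero_mul] at hint
  have hcap : ∫ s in (0 : ℝ)..(n * k), ((n : ℝ) * k - s) ^ (-α) • deriv u s
      = k ^ (-α) • ∫ s in (0 : ℝ)..n,
        ((n : ℝ) - s) ^ (-α) • (k • derivWithin u (Set.Ioc 0 T) (s * k)) := by
    rw [← smul_inv_smul₀ hk.ne' (∫ s in (0 : ℝ)..(n * k), ((n : ℝ) * k - s) ^ (-α) • deriv u s),
      ← hint, ← intervalIntegral.integral_smul, ← intervalIntegral.integral_smul]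
    refine intervalIntegral.integral_congr_ae ?_
    -- At `s = n` the point `s k` may be `T`, where `deriv u` need not be the one-sided derivative;
    -- this is a null set.
    have hne : ∀ᵐ s : ℝ, s ≠ (n : ℝ) := by simp [ae_iff]
    filter_upwards [hne] with s hs hmem
    rw [Set.uIoc_of_le (Nat.cast_nonneg n)] at hmem
    have hlt : s < n := lt_of_le_of_ne hmem.2 hs
    have hnhds : Set.Ioc 0 T ∈ 𝓝 (s * k) :=
      mem_of_superset (Ioo_mem_nhds (mul_pos hmem.1 hk)
        (lt_of_lt_of_le (mul_lt_mul_of_pos_right hlt hk) hn)) Set.Ioo_subset_Ioc_self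
    rw [derivWithin_of_mem_nhds hnhds, ← sub_mul, Real.mul_rpow (by linarith) hk.le, smul_smul,
      smul_smul, smul_smul]
    congr 1
    ring
  rw [truncationError, hsum, caputoDeriv, hcap, smul_sub, smul_comm]

end

/-- Bernoulli for `(j/(j+1))^α` bounds each term by a difference of `j^α / α`, and the sum
telescopes. -/
theorem sum_range_rpow_le {α : ℝ} (hα₀ : 0 < α) (hα₁ : α < 1) (n : ℕ) :
    ∑ j ∈ Finset.range n, ((j : ℝ) + 1) ^ (α - 1) ≤ (n : ℝ) ^ α / α := by
  have h : ∀ j ∈ Finset.range n, ((j : ℝ) + 1) ^ (α - 1)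
      ≤ (((j + 1 : ℕ) : ℝ) ^ α - (j : ℝ) ^ α) / α := by
    intro j _
    have hj : (0 : ℝ) < (j : ℝ) + 1 := by positivity
    have hb := rpow_one_add_le_one_add_mul_self (s := -1 / ((j : ℝ) + 1)) (by
      rw [le_div_iff₀ hj]
      linarith [(Nat.cast_nonneg j : (0 : ℝ) ≤ j)]) hα₀.le hα₁.le
    rw [show 1 + -1 / ((j : ℝ) + 1) = j / ((j : ℝ) + 1) by field_simp; ring,
      Real.div_rpow (Nat.cast_nonneg j) hj.le, div_le_iff₀ (by positivity)] at hb
    rw [le_div_iff₀ hα₀, Real.rpow_sub_one hj.ne']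
    push_cast
    have e : (1 + α * (-1 / ((j : ℝ) + 1))) * ((j : ℝ) + 1) ^ α
        = ((j : ℝ) + 1) ^ α - ((j : ℝ) + 1) ^ α / ((j : ℝ) + 1) * α := by
      field_simp
      ring
    rw [e] at hb
    linarith
  refine (Finset.sum_le_sum h).trans_eq ?_
  rw [← Finset.sum_div, Finset.sum_range_sub (fun j : ℕ => (j : ℝ) ^ α)]
  simp [Real.zero_rpow hα₀.ne']

/-- Discrete fractional integration of a sequence of order `-σ`, `1 ≤ σ ≤ 2`. -/
theorem sum_rpow_mul_rpow_le {α σ : ℝ} (hα₀ : 0 < α) (hα₁ : α < 1) (hσ₁ : 1 ≤ σ) (hσ₂ : σ ≤ 2)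
    {n : ℕ} (hn : 1 ≤ n) :
    ∑ j ∈ Finset.range n, ((n : ℝ) - j) ^ (α - 1) * ((j : ℝ) + 1) ^ (-σ)
      ≤ 4 * (n : ℝ) ^ (α - 1) * (∑ j ∈ Finset.range n, ((j : ℝ) + 1) ^ (-σ) + 1 / α) := by
  have hn1 : (1 : ℝ) ≤ n := by exact_mod_cast hn
  have hn0 : (0 : ℝ) < n := by linarith
  have hterm : ∀ j ∈ Finset.range n, ((n : ℝ) - j) ^ (α - 1) * ((j : ℝ) + 1) ^ (-σ)
      ≤ ((n : ℝ) / 2) ^ (α - 1) * ((j : ℝ) + 1) ^ (-σ)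
        + ((n : ℝ) / 2) ^ (-σ) * ((n : ℝ) - j) ^ (α - 1) := by
    intro j hj
    have hjn : (j : ℝ) < n := by exact_mod_cast Finset.mem_range.1 hj
    rw [show α - 1 = -(1 - α) by ring]
    exact rpow_neg_mul_rpow_neg_le (by linarith) (by positivity) hn0 (by linarith) (by linarith)
      (by linarith)
  have hrefl : ∑ j ∈ Finset.range n, ((n : ℝ) - j) ^ (α - 1)
      = ∑ j ∈ Finset.range n, ((j : ℝ) + 1) ^ (α - 1) := by
    rw [← Finset.sum_range_reflect]
    refine Finset.sum_congr rfl fun j hj => ?_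
    have hj := Finset.mem_range.1 hj
    rw [show n - 1 - j = n - (j + 1) by omega, Nat.cast_sub hj]
    push_cast
    ring_nf
  have h1 : ((n : ℝ) / 2) ^ (α - 1) ≤ 4 * (n : ℝ) ^ (α - 1) := by
    rw [show α - 1 = -(1 - α) by ring]
    have := rpow_neg_le_of_le_mul (x := (n : ℝ) / 2) (y := n) (c := 2) (γ := 1 - α) (by positivity)
      hn0 (by norm_num) (by linarith) (by linarith) (by linarith)
    linarith
  have h2 : ((n : ℝ) / 2) ^ (-σ) * ((n : ℝ) ^ α / α) ≤ 4 * (n : ℝ) ^ (α - 1) * (1 / α) := by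
    have h3 := rpow_neg_le_of_le_mul (x := (n : ℝ) / 2) (y := n) (c := 2) (γ := σ) (by positivity)
      hn0 (by norm_num) (by linarith) hσ₂ (by linarith)
    have h4 : (n : ℝ) ^ (-σ) * (n : ℝ) ^ α ≤ (n : ℝ) ^ (α - 1) := by
      rw [← Real.rpow_add hn0]
      exact Real.rpow_le_rpow_of_exponent_le hn1 (by linarith)
    calc _ ≤ 2 ^ 2 * (n : ℝ) ^ (-σ) * ((n : ℝ) ^ α / α) := by gcongr
      _ = 4 * ((n : ℝ) ^ (-σ) * (n : ℝ) ^ α) * (1 / α) := by ring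
      _ ≤ _ := by gcongr
  calc _ ≤ ∑ j ∈ Finset.range n, (((n : ℝ) / 2) ^ (α - 1) * ((j : ℝ) + 1) ^ (-σ)
        + ((n : ℝ) / 2) ^ (-σ) * ((n : ℝ) - j) ^ (α - 1)) := Finset.sum_le_sum hterm
    _ = ((n : ℝ) / 2) ^ (α - 1) * ∑ j ∈ Finset.range n, ((j : ℝ) + 1) ^ (-σ)
        + ((n : ℝ) / 2) ^ (-σ) * ∑ j ∈ Finset.range n, ((j : ℝ) + 1) ^ (α - 1) := by
        rw [Finset.sum_add_distrib, ← Finset.mul_sum, ← Finset.mul_sum, hrefl]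
    _ ≤ 4 * (n : ℝ) ^ (α - 1) * ∑ j ∈ Finset.range n, ((j : ℝ) + 1) ^ (-σ)
        + 4 * (n : ℝ) ^ (α - 1) * (1 / α) := by
        refine add_le_add ?_ (le_trans ?_ h2)
        · gcongr
        · gcongr
          exact sum_range_rpow_le hα₀ hα₁ n
    _ = _ := by ring

theorem sum_range_inv_le_one_add_log (n : ℕ) :
    ∑ j ∈ Finset.range n, ((j : ℝ) + 1) ^ (-1 : ℝ) ≤ 1 + Real.log n := by
  have h := harmonic_le_one_add_log n
  rw [harmonic] at h
  push_cast at h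
  simpa only [Real.rpow_neg_one] using h

/-- The sums `∑_{j < n} (j + 1) ^ (-σ)`, up to an additive constant, in terms of the rate. -/
theorem exists_sum_rpow_le_bdfRate {p : ℕ} {α σ T h₀ : ℝ} (hα₀ : 0 < α) (hσ₁ : 1 ≤ σ)
    (hσ : p ≠ 1 → 1 < σ) (hT : 0 < T) (hh₀ : 0 < h₀) (hh₁ : h₀ < 1) :
    ∃ K : ℝ, 0 < K ∧ ∀ h : ℝ, 0 < h → (p = 1 → h ≤ h₀) → ∀ n : ℕ, 1 ≤ n → (n : ℝ) * h ≤ T →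
      h * (∑ j ∈ Finset.range n, ((j : ℝ) + 1) ^ (-σ) + 1 / α) ≤ K * bdfRate p h := by
  by_cases hp : p = 1
  · have hl0 : 0 < Real.log h₀⁻¹ := Real.log_pos ((one_lt_inv₀ hh₀).2 hh₁)
    -- From `n ≤ T/h` the harmonic sum is at most `1 + log T + log h⁻¹`. As `h ≤ h₀ < 1` keeps `log
    -- h⁻¹` above `log h₀⁻¹ > 0`, the constants are absorbed into the logarithm.
    set c := 1 + |Real.log T| + 1 / α
    have hc : 0 < c := by positivity
    refine ⟨1 + c / Real.log h₀⁻¹, by positivity, fun h hh hle n hn hnT => ?_⟩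
    have hn0 : (0 : ℝ) < n := by exact_mod_cast hn
    have hl : Real.log h₀⁻¹ ≤ Real.log h⁻¹ :=
      Real.log_le_log (by positivity) (inv_anti₀ hh (hle hp))
    have hlogn : Real.log n ≤ Real.log T + Real.log h⁻¹ := by
      rw [← Real.log_mul hT.ne' (by positivity)]
      refine Real.log_le_log hn0 ?_
      rwa [← div_eq_mul_inv, le_div_iff₀ hh]
    have hsum : ∑ j ∈ Finset.range n, ((j : ℝ) + 1) ^ (-σ) ≤ 1 + Real.log n := by
      refine (Finset.sum_le_sum fun j _ => ?_).trans (sum_range_inv_le_one_add_log n)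
      exact Real.rpow_le_rpow_of_exponent_le
        (by linarith [(Nat.cast_nonneg j : (0 : ℝ) ≤ j)]) (by linarith)
    have hfin : c ≤ c / Real.log h₀⁻¹ * Real.log h⁻¹ := by
      rw [div_mul_eq_mul_div, le_div_iff₀ hl0]
      gcongr
    rw [bdfRate, if_pos hp]
    calc h * (∑ j ∈ Finset.range n, ((j : ℝ) + 1) ^ (-σ) + 1 / α)
        ≤ h * (Real.log h⁻¹ + c / Real.log h₀⁻¹ * Real.log h⁻¹) := by
          refine mul_le_mul_of_nonneg_left ?_ hh.le
          have := le_abs_self (Real.log T)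
          simp only [c] at hfin ⊢
          linarith
      _ = _ := by ring
  · have hs : Summable fun j : ℕ => ((j : ℝ) + 1) ^ (-σ) := by
      have h1 := (summable_nat_add_iff 1).2 (Real.summable_nat_rpow.2 (by linarith [hσ hp] :
        -σ < -1))
      simpa using h1
    have hts : 0 ≤ ∑' j : ℕ, ((j : ℝ) + 1) ^ (-σ) := tsum_nonneg fun j => by positivity
    refine ⟨∑' j : ℕ, ((j : ℝ) + 1) ^ (-σ) + 1 / α, by positivity, fun h hh _ n _ _ => ?_⟩
    rw [bdfRate, if_neg hp, mul_comm]
    gcongr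
    exact hs.sum_le_tsum _ fun j _ => by positivity

end

/-! ### The truncation bound -/

theorem mainTheorem6 {E : Type*} [NormedAddCommGroup E] [NormedSpace ℝ E] [CompleteSpace E]
    (p : ℕ) (hp₁ : 1 ≤ p) (hp₆ : p ≤ 6)
    (α : ℝ) (hα₀ : 0 < α) (hα₁ : α < 1)
    (T : ℝ) (hT : 0 < T) (M : ℝ) (h₀ : ℝ) (hh₀ : 0 < h₀) (hh₁ : h₀ < 1) :
    ∃ C : ℝ, 0 < C ∧
      ∀ u : ℝ → E, SolutionRegularity α T M u →
        ∀ h : ℝ, 0 < h → (p = 1 → h ≤ h₀) →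
          TruncationBound p α T u h 0 (C * bdfRate p h) := by
  obtain ⟨σ, C, hC, hσ₁, hσ₂, hσ, herr⟩ := exists_rescaled_error_bound (E := E) hp₁ hp₆ hα₀ hα₁
  obtain ⟨K, hK, hsum⟩ := exists_sum_rpow_le_bdfRate (p := p) hα₀ hσ₁ hσ hT hh₀ hh₁
  -- The constant is fixed before any `u` is given; `|M| + 1` keeps it positive even for `M ≤ 0`.
  refine ⟨4 * C * (|M| + 1) * K, by positivity, fun u hu h hh hle n hn hnT => ?_⟩
  have hn0 : (0 : ℝ) < n := by exact_mod_cast hn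
  have hM : 0 ≤ M := by
    have h1 := hu.bound 0 (by norm_num) T ⟨hT, le_rfl⟩
    by_contra hneg
    have := mul_neg_of_neg_of_pos (not_le.1 hneg) (Real.rpow_pos_of_pos hT (α - ((0 : ℕ) : ℝ)))
    linarith [norm_nonneg (iteratedDerivWithin 0 u (Set.Ioc 0 T) T)]
  have hζ : ∀ j ∈ Finset.range n, ‖truncationError p α h u (j + 1)‖
      ≤ C * (|M| + 1) * ((j : ℝ) + 1) ^ (-σ) := by
    intro j hj
    have hjn : ((j + 1 : ℕ) : ℝ) * h ≤ T := by
      refine le_trans ?_ hnT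
      gcongr
      exact_mod_cast Finset.mem_range.1 hj
    have h1 := herr h hh (j + 1) (by omega) _ _ _ _ (hu.rescale hα₀ hh hjn) (by positivity)
    have hhh : h ^ (-α) * h ^ α = 1 := by
      rw [← Real.rpow_add hh, neg_add_cancel, Real.rpow_zero]
    rw [truncationError_eq_rescaled hh hjn, norm_smul, Real.norm_of_nonneg (by positivity)]
    calc _ ≤ h ^ (-α) * (C * (M * h ^ α) * ((j + 1 : ℕ) : ℝ) ^ (-σ)) := by gcongr
      _ = (h ^ (-α) * h ^ α) * (C * M * ((j + 1 : ℕ) : ℝ) ^ (-σ)) := by ring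
      _ = C * M * ((j : ℝ) + 1) ^ (-σ) := by
          rw [hhh, one_mul]
          push_cast
          rfl
      _ ≤ _ := by
          gcongr
          linarith [le_abs_self M]
  rw [discreteFracIntegral, zero_add]
  calc h ^ α * ∑ j ∈ Finset.range n,
        ((n : ℝ) - j) ^ (α - 1) * ‖truncationError p α h u (j + 1)‖
      ≤ h ^ α * ∑ j ∈ Finset.range n,
        C * (|M| + 1) * (((n : ℝ) - j) ^ (α - 1) * ((j : ℝ) + 1) ^ (-σ)) := by
        refine mul_le_mul_of_nonneg_left (Finset.sum_le_sum fun j hj => ?_) (by positivity)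
        have hjn : (j : ℝ) < n := by exact_mod_cast Finset.mem_range.1 hj
        have hpos : 0 ≤ ((n : ℝ) - j) ^ (α - 1) := Real.rpow_nonneg (by linarith) _
        calc _ ≤ ((n : ℝ) - j) ^ (α - 1) * (C * (|M| + 1) * ((j : ℝ) + 1) ^ (-σ)) :=
              mul_le_mul_of_nonneg_left (hζ j hj) hpos
          _ = _ := by ring
    _ ≤ h ^ α * (C * (|M| + 1) * (4 * (n : ℝ) ^ (α - 1)
          * (∑ j ∈ Finset.range n, ((j : ℝ) + 1) ^ (-σ) + 1 / α))) := by
        rw [← Finset.mul_sum]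
        gcongr
        exact sum_rpow_mul_rpow_le hα₀ hα₁ hσ₁ hσ₂ hn
    -- Here `h^α n^(α-1) = h (n h)^(α-1)`, which is the source of the first-order factor `h`.
    _ = 4 * C * (|M| + 1) * (h * (∑ j ∈ Finset.range n, ((j : ℝ) + 1) ^ (-σ) + 1 / α))
          * ((n : ℝ) * h) ^ (α - 1) := by
        rw [Real.mul_rpow hn0.le hh.le, Real.rpow_sub_one hh.ne']
        field_simp
    _ ≤ 4 * C * (|M| + 1) * (K * bdfRate p h) * ((n : ℝ) * h) ^ (α - 1) := by
        exact mul_le_mul_of_nonneg_right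
          (mul_le_mul_of_nonneg_left (hsum h hh hle n hn hnT) (by positivity)) (by positivity)
    _ = _ := by ring
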